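/- Graphs are finite and may have loops and parallel edges. A separation of order $t$ of a graph $G$ is a pair $(A,B)$ of subgraphs of $G$ with $A\cup B=G$, $E(A\cap B)=\emptyset$ and $|V(A\cap B)|=t$. A pseudomodel of a graph $H$ in $G$ is a map $\eta$ with domain $V(H)\cup E(H)$ such that: the $\eta(v)$ ($v\in V(H)$) are non-null pairwise vertex-disjoint subgraphs of $G$; the $\eta(e)$ ($e\in E(H)$) are distinct edges of $G$; $\eta(e)\notin E(\eta(v))$ for all $e\in E(H)$, $v\in V(H)$; and for each edge $e=uv$ of $H$, $\eta(e)$ has one end in $V(\eta(u))$ and the other in $V(\eta(v))$ (if $u=v$, all ends of $\eta(e)$ are in $V(\eta(v))$). It is a model if moreover every $\eta(v)$ is connected. For a set $F\subseteq V(H)$, $\eta(F)=\bigcup_{v\in F}V(\eta(v))$. The grid $\mathcal G_n$ has vertices $v_{ij}$ ($1\le i,j\le n$), with $v_{ij},v_{i'j'}$ adjacent if and only if $|i-i'|+|j-j'|=1$; its rows are the sets $\{v_{i1},\dots,v_{in}\}$. The boundary of a subgraph $J$ of $\mathcal G_n$ is the set of vertices of $J$ incident with an edge of $\mathcal G_n$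 that is not in $E(J)$. For $Z\subseteq V(G)$ with $|Z|=k\le g$, a model $\eta$ of $\mathcal G_g$ in $G$ is $Z$-augmentable in $G$ if there is a model $\eta'$ of $\mathcal G_g$ in $G$ such that, for some labelling of the vertices of $\mathcal G_g$ as above (i.e. up to an automorphism of $\mathcal G_g$): $\eta'(v_{ij})=\eta(v_{ij})$ whenever $j\ge 2$ or $i>k$; $\eta'(v_{i1})\supseteq\eta(v_{i1})$ and $V(\eta'(v_{i1}))\cap Z\ne\emptyset$ for $1\le i\le k$; and $\eta'(e)=\eta(e)$ for every edge $e$ of $\mathcal G_g$. Theorem. Let $g,k,n$ be integers with $g\ge k\ge 1$, $n>k(g+2k)$ and $n\ge 2g$ (the last condition is automatic if $k\ge 2$). Let $G$ be a graph and $Z\subseteq V(G)$ with $|Z|=k$. Let $J$ be a subgraph of $\mathcal G_n$, with boundary $\beta$, whose vertex set includes at least one row of $\mathcal G_n$, and let $\eta$ be a pseudomodel of $J$ in $G$. Suppose that (i) for each $v\in V(J)$, either $\eta(v)$ is connected and $v\notin\beta$, or every component of $\eta(v)$ contains a vertex of $Z$; and (ii) there is no separation $(A,B)$ of $G$ of order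 less than $k$ such that $Z\subseteq V(A)$ and $\eta(R)\subseteq V(B)$ for some row $R$ of $\mathcal G_n$ with $R\subseteq V(J)$. Then there is a subgraph $H$ of $J$, isomorphic to $\mathcal G_g$, such that $Z\cap V(\eta(v))=\emptyset$ for every $v\in V(H)$, and the restriction of $\eta$ to $H$ is a $Z$-augmentable model of $\mathcal G_g$ in $G$. -/

import Mathlib

open scoped Graph

namespace RootedGrid

variable {α β γ δ : Type*}

/-- The equivalence relation of being joined by a walk (for vertices `x`, `y` of `G`). -/
def Joined (G : Graph α β) (x y : α) : Prop :=
  Relation.ReflTransGen G.Adj x y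

/-- A graph is connected if it is non-null and any two of its vertices are joined by a walk. -/
def IsConnected (G : Graph α β) : Prop :=
  V(G).Nonempty ∧ ∀ x ∈ V(G), ∀ y ∈ V(G), Joined G x y

/-- The components of `G`: the subgraphs induced on the classes of vertices of `G` under the
relation of being joined by a walk. -/
def IsComponent (C G : Graph α β) : Prop :=
  ∃ x ∈ V(G), C = G.induce {y | y ∈ V(G) ∧ Joined G x y}

/-- `(A, B)` is a separation of `G`: `A`, `B` are subgraphs with `A ∪ B = G` and
`E(A ∩ B) = ∅`. -/
structure IsSeparation (G A B : Graph α β) : Prop where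
  left_le : A ≤ G
  right_le : B ≤ G
  vertexSet_union : V(A) ∪ V(B) = V(G)
  edgeSet_union : E(A) ∪ E(B) = E(G)
  edgeSet_inter : E(A) ∩ E(B) = ∅

/-- The order `|V(A ∩ B)|` of a separation `(A, B)` (of a finite graph). -/
noncomputable def sepOrder (A B : Graph α β) : ℕ :=
  (V(A) ∩ V(B)).ncard

/-- The boundary of a subgraph `H` in `G`: the vertices of `H` incident with an edge of `G`
that does not belong to `H`. -/
def boundary (G H : Graph α β) : Set α :=
  {v | v ∈ V(H) ∧ ∃ e ∈ E(G), e ∉ E(H) ∧ G.Inc e v}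

/-- The data of a map `η` that sends vertices of one graph to graphs, and edges of it to
edges. Only the values on the vertices and edges of the graph in question matter. -/
structure GraphMap (γ δ α β : Type*) where
  vert : γ → Graph α β
  edge : δ → β

/-- `η`, read along the relabelling `f` of vertices and `h` of edges. -/
def GraphMap.comp {γ' δ' : Type*} (η : GraphMap γ δ α β) (f : γ' → γ) (h : δ' → δ) :
    GraphMap γ' δ' α β where
  vert v := η.vert (f v)
  edge e := η.edge (h e)

/-- `η` (restricted to `V(H) ∪ E(H)`) is a pseudomodel of `H` in `G`. -/
structure IsPseudomodel (H : Graph γ δ) (G : Graph α β) (η : GraphMap γ δ α β) : Prop where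
  vert_le : ∀ v ∈ V(H), η.vert v ≤ G
  vert_nonempty : ∀ v ∈ V(H), V(η.vert v).Nonempty
  vert_disjoint : ∀ u ∈ V(H), ∀ v ∈ V(H), u ≠ v → Disjoint V(η.vert u) V(η.vert v)
  edge_mem : ∀ e ∈ E(H), η.edge e ∈ E(G)
  edge_injOn : Set.InjOn η.edge E(H)
  edge_notMem : ∀ e ∈ E(H), ∀ v ∈ V(H), η.edge e ∉ E(η.vert v)
  edge_link : ∀ e u v, H.IsLink e u v →
    ∃ x ∈ V(η.vert u), ∃ y ∈ V(η.vert v), G.IsLink (η.edge e) x y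

/-- A model is a pseudomodel all of whose branch sets are connected. -/
structure IsModel (H : Graph γ δ) (G : Graph α β) (η : GraphMap γ δ α β) : Prop
    extends IsPseudomodel H G η where
  vert_connected : ∀ v ∈ V(H), IsConnected (η.vert v)

/-- `f` on vertices and `h` on edges form an isomorphism from `H` to `H'`. -/
structure IsIso {γ' δ' : Type*} (H : Graph γ δ) (H' : Graph γ' δ')
    (f : γ → γ') (h : δ → δ') : Prop where
  bijOn_vert : Set.BijOn f V(H) V(H')
  bijOn_edge : Set.BijOn h E(H) E(H')
  isLink_iff : ∀ e ∈ E(H), ∀ x ∈ V(H), ∀ y ∈ V(H),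
    (H.IsLink e x y ↔ H'.IsLink (h e) (f x) (f y))

/-- The vertices `v_{ij}` of the `n × n` grid; indices start at `0`. -/
abbrev GridVert (n : ℕ) := Fin n × Fin n

/-- The edges of the `n × n` grid are unordered pairs of vertices. -/
abbrev GridEdge (n : ℕ) := Sym2 (GridVert n)

/-- The `n × n` grid as a simple graph: `(i, j)` and `(i', j')` are adjacent if and only if
`|i' - i| + |j' - j| = 1`. -/
def gridSimple (n : ℕ) : SimpleGraph (GridVert n) where
  Adj u v := |((v.1 : ℕ) : ℤ) - ((u.1 : ℕ) : ℤ)| + |((v.2 : ℕ) : ℤ) - ((u.2 : ℕ) : ℤ)| = 1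
  symm := ⟨fun u v h => by
    rw [abs_sub_comm ((u.1 : ℕ) : ℤ), abs_sub_comm ((u.2 : ℕ) : ℤ)]; exact h⟩
  loopless := ⟨fun u h => by simp at h⟩

/-- The `n × n` grid. -/
def grid (n : ℕ) : Graph (GridVert n) (GridEdge n) :=
  Graph.ofSimpleGraph (gridSimple n)

/-- The `i`-th row of the `n × n` grid. -/
def row (n : ℕ) (i : Fin n) : Set (GridVert n) :=
  {v | v.1 = i}

/-- `η(F)` for a set `F` of vertices: the union of the vertex sets of the graphs `η(v)`,
`v ∈ F`. -/
def GraphMap.image (η : GraphMap γ δ α β) (F : Set γ) : Set α :=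
  ⋃ v ∈ F, V(η.vert v)

/-- `η'` is a model of the `g × g` grid in `G` that augments `η`, with the given labelling of
the grid: it agrees with `η` except that the images of the first `|Z|` vertices of the first
column may grow, and these images each contain a member of `Z`. -/
structure IsAugmentationLabelled (G : Graph α β) (Z : Set α) (g : ℕ)
    (η η' : GraphMap (GridVert g) (GridEdge g) α β) : Prop where
  isModel : IsModel (grid g) G η'
  vert_other : ∀ i j : Fin g, (j : ℕ) ≠ 0 → η'.vert (i, j) = η.vert (i, j)
  vert_first_large : ∀ i j : Fin g, (j : ℕ) = 0 → Z.ncard ≤ (i : ℕ) →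
    η'.vert (i, j) = η.vert (i, j)
  vert_first_small : ∀ i j : Fin g, (j : ℕ) = 0 → (i : ℕ) < Z.ncard →
    η.vert (i, j) ≤ η'.vert (i, j)
  vert_first_mem : ∀ i j : Fin g, (j : ℕ) = 0 → (i : ℕ) < Z.ncard →
    (V(η'.vert (i, j)) ∩ Z).Nonempty
  edge_eq : ∀ e ∈ E(grid g), η'.edge e = η.edge e

/-- `η` is a `Z`-augmentable model of the `g × g` grid in `G`: it is a model and, for some
labelling of the grid as usual (that is, up to an automorphism `(σ, τ)` of the grid), it has an
augmentation. -/
def IsAugmentable (G : Graph α β) (Z : Set α) (g : ℕ)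
    (η : GraphMap (GridVert g) (GridEdge g) α β) : Prop :=
  IsModel (grid g) G η ∧
    ∃ (σ : GridVert g → GridVert g) (τ : GridEdge g → GridEdge g),
      IsIso (grid g) (grid g) σ τ ∧
      ∃ η' : GraphMap (GridVert g) (GridEdge g) α β,
        IsAugmentationLabelled G Z g (η.comp σ τ) η'

end RootedGrid

namespace RootedGrid

/-! ### Reachability inside a set -/

/-! Only the adjacency relation `r` of `G` and the vertex sets `N v` of the branch sets matter: the
hypotheses become `Config` and the goal becomes `HasRootedGrid`.

The engine is the propagation of cuts. A branch set that `S` cuts off from `Z` misses `Z`; hence by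
(i) it is connected and joined to all its grid neighbours, so every neighbour avoiding `S` is again
nonempty and cut off (`Web.isCut_step`). If `|S| < k`, some row and some column avoid `S`. A single
cut branch set in an `S`-free column therefore forces a whole row to be cut, against (ii)
(`Config.not_isCut`).

By induction on the number of related pairs, `Config.hasRootedGrid` reduces to the case where `r` is
local with respect to the grid (`IsTight`). Delete a pair that neither lies in one branch set nor
joins two neighbouring ones. If (ii) fails afterwards, `k - 1` vertices separate `Z` from some row;
together with one end of the deleted pair they form a `k`-set `Z'` that replaces `Z` on the far
side, and Menger's theorem links `Z` to `Z'` on the near side. Truncation may disconnect branch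
sets, but every component of a damaged one meets `Z'`. This is why (i) admits disconnected branch
sets.

In a tight configuration a walk can enter a square of branch sets only through its outer ring. For
`k ≥ 2` pigeonhole gives a `Z`-free square of side `g + 2k`: a central `g × g` grid inside `k`
concentric rings. Fewer than `k` vertices separating `Z` from the left-hand access points of `k`
central rows would miss a ring and one of these rows, hence cut off that ring, hence a full row. So
Menger's theorem supplies the `k` disjoint connections (`Config.hasRootedGrid_of_square`). For `k =
1` one connection around the grid is found directly (`Config.hasRootedGrid_one`). -/

/-- `y` can be reached from `x` by `r`-steps between elements of `P`. -/
def Reach {α : Type*} (r : α → α → Prop) (P : Set α) (x y : α) : Prop :=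
  Relation.ReflTransGen (fun u v => r u v ∧ u ∈ P ∧ v ∈ P) x y

/-- Any two elements of `P` can be reached from each other by `r`-steps inside `P`. -/
def ConnOn {α : Type*} (r : α → α → Prop) (P : Set α) : Prop :=
  ∀ x ∈ P, ∀ y ∈ P, Reach r P x y

section Reach

variable {α : Type*} {r r' : α → α → Prop} {P P' Q : Set α} {x y z : α}

theorem Reach.refl (x : α) : Reach r P x x := Relation.ReflTransGen.refl

theorem Reach.trans (h : Reach r P x y) (h' : Reach r P y z) : Reach r P x z :=
  Relation.ReflTransGen.trans h h'

theorem Reach.single (h : r x y) (hx : x ∈ P) (hy : y ∈ P) : Reach r P x y :=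
  Relation.ReflTransGen.single ⟨h, hx, hy⟩

theorem Reach.tail (h : Reach r P x y) (hyz : r y z) (hy : y ∈ P) (hz : z ∈ P) :
    Reach r P x z :=
  Relation.ReflTransGen.tail h ⟨hyz, hy, hz⟩

theorem Reach.mono (h : Reach r P x y) (hr : ∀ u v, u ∈ P → v ∈ P → r u v → r' u v)
    (hP : P ⊆ P') : Reach r' P' x y :=
  Relation.ReflTransGen.mono (fun u v ⟨h1, h2, h3⟩ => ⟨hr u v h2 h3 h1, hP h2, hP h3⟩) _ _ h

theorem Reach.mono_set (h : Reach r P x y) (hP : P ⊆ P') : Reach r P' x y :=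
  h.mono (fun _ _ _ _ h => h) hP

theorem Reach.symm (hs : ∀ ⦃u v⦄, r u v → r v u) (h : Reach r P x y) : Reach r P y x := by
  induction h with
  | refl => exact Reach.refl _
  | tail _ h ih => exact (Reach.single (hs h.1) h.2.2 h.2.1).trans ih

theorem Reach.mem (h : Reach r P x y) (hx : x ∈ P) : y ∈ P := by
  induction h with
  | refl => exact hx
  | tail _ h _ => exact h.2.2

theorem Reach.eq_or_mem (h : Reach r P x y) : x = y ∨ ∃ u, r u y := by
  induction h with
  | refl => exact Or.inl rfl
  | tail _ h _ => exact Or.inr ⟨_, h.1⟩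

/-- A walk that leaves a set has a first step that leaves it. -/
theorem Reach.exists_exit (h : Reach r P x y) (hx : x ∈ Q) (hy : y ∉ Q) :
    ∃ u v, Reach r (P ∩ Q) x u ∧ u ∈ Q ∧ v ∉ Q ∧ r u v ∧ u ∈ P ∧ v ∈ P := by
  have key : (Reach r (P ∩ Q) x y ∧ y ∈ Q) ∨
      ∃ u v, Reach r (P ∩ Q) x u ∧ u ∈ Q ∧ v ∉ Q ∧ r u v ∧ u ∈ P ∧ v ∈ P := by
    clear hy
    induction h with
    | refl => exact Or.inl ⟨Reach.refl _, hx⟩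
    | @tail b c _ h ih =>
      rcases ih with ⟨ih, hb⟩ | ih
      · by_cases hc : c ∈ Q
        · exact Or.inl ⟨ih.tail h.1 ⟨h.2.1, hb⟩ ⟨h.2.2, hc⟩, hc⟩
        · exact Or.inr ⟨b, c, ih, hb, hc, h.1, h.2.1, h.2.2⟩
      · exact Or.inr ih
  rcases key with ⟨_, h⟩ | h
  · exact absurd h hy
  · exact h

theorem ConnOn.mono (h : ConnOn r P) (hr : ∀ u v, u ∈ P → v ∈ P → r u v → r' u v) :
    ConnOn r' P :=
  fun x hx y hy => (h x hx y hy).mono hr subset_rfl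

theorem ConnOn.singleton (x : α) : ConnOn r {x} := by
  rintro _ rfl _ rfl
  exact Reach.refl _

theorem ConnOn.union (hs : ∀ ⦃u v⦄, r u v → r v u) (hP : ConnOn r P) (hQ : ConnOn r Q) (hx : x ∈ P)
    (hy : y ∈ Q) (hxy : x = y ∨ r x y) : ConnOn r (P ∪ Q) := by
  have hxy' : Reach r (P ∪ Q) x y := by
    rcases hxy with rfl | h
    · exact Reach.refl _
    · exact Reach.single h (Or.inl hx) (Or.inr hy)
  have key : ∀ u ∈ P ∪ Q, Reach r (P ∪ Q) u x := by
    rintro u (hu | hu)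
    · exact (hP u hu x hx).mono_set Set.subset_union_left
    · exact ((hQ u hu y hy).mono_set Set.subset_union_right).trans (hxy'.symm hs)
  exact fun u hu v hv => (key u hu).trans ((key v hv).symm hs)

end Reach

/-! ### Counting -/

section Counting

variable {α : Type*}

theorem exists_disjoint_of_ncard_lt {k : ℕ} {S : Set α} (hS : S.Finite) (hk : S.ncard < k)
    (A : ℕ → Set α) (hA : ∀ i < k, ∀ j < k, i ≠ j → Disjoint (A i) (A j)) :
    ∃ i < k, Disjoint (A i) S := by
  by_contra! hcon
  have : ∀ i, ∃ x, i < k → x ∈ A i ∧ x ∈ S := by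
    intro i
    by_cases hi : i < k
    · obtain ⟨x, hx⟩ := Set.not_disjoint_iff.1 (hcon i hi)
      exact ⟨x, fun _ => hx⟩
    -- For `i ≥ k` any value serves; index `0` supplies one, since `k > 0`.
    · obtain ⟨x, -⟩ := Set.not_disjoint_iff.1 (hcon 0 (by omega))
      exact ⟨x, fun h => absurd h hi⟩
  choose p hp using this
  have h1 : (Finset.range k : Set ℕ).ncard ≤ S.ncard := by
    refine Set.ncard_le_ncard_of_injOn p (fun i hi => (hp i (by simpa using hi)).2) ?_ hS
    intro i hi j hj hij
    by_contra hne
    have hi' : i < k := by simpa using hi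
    have hj' : j < k := by simpa using hj
    exact Set.disjoint_left.1 (hA i hi' j hj' hne) (hp i hi').1 (hij ▸ (hp j hj').1)
  rw [Set.ncard_coe_finset, Finset.card_range] at h1
  omega

/-- `k` disjoint sets meeting a set of size `k` determine an enumeration of it. -/
theorem exists_transversal {k : ℕ} {X : Set α} (hX : X.Finite) (hk : X.ncard = k)
    {P : Fin k → Set α} (hP : ∀ i j, i ≠ j → Disjoint (P i) (P j))
    (h : ∀ i, (P i ∩ X).Nonempty) :
    ∃ p : Fin k → α, (∀ i, p i ∈ P i) ∧ (∀ i, p i ∈ X) ∧ (∀ x ∈ X, ∃ i, p i = x) ∧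
      ∀ i, ∀ x ∈ X, x ∈ P i → p i = x := by
  choose p hp using h
  have hinj : Function.Injective p := by
    intro i j hij
    by_contra hne
    exact Set.disjoint_left.1 (hP i j hne) (hp i).1 (hij ▸ (hp j).1)
  have hr : Set.range p = X := by
    refine Set.eq_of_subset_of_ncard_le (by rintro _ ⟨i, rfl⟩; exact (hp i).2) ?_ hX
    rw [← Set.image_univ, Set.ncard_image_of_injective _ hinj, Set.ncard_univ]
    simp [hk]
  have hsurj : ∀ x ∈ X, ∃ i, p i = x := fun x hx => by rw [← hr] at hx; exact hx
  refine ⟨p, fun i => (hp i).1, fun i => (hp i).2, hsurj, fun i x hx hxi => ?_⟩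
  obtain ⟨j, rfl⟩ := hsurj x hx
  by_contra hne
  have hij : i ≠ j := fun h => hne (h ▸ rfl)
  exact Set.disjoint_left.1 (hP i j hij) hxi (hp j).1

end Counting

/-! ### Menger's theorem -/

section Menger

variable {α : Type*}

/-- `S` meets every walk from `A` to `B`. -/
def Separates (r : α → α → Prop) (A B S : Set α) : Prop :=
  ∀ a ∈ A, a ∉ S → ∀ b ∈ B, b ∉ S → ¬ Reach r Sᶜ a b

/-- There are `k` disjoint connected sets that meet both `A` and `B`. -/
def Linked (r : α → α → Prop) (k : ℕ) (A B : Set α) : Prop :=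
  ∃ P : Fin k → Set α, (∀ i, ConnOn r (P i)) ∧ (∀ i, (P i ∩ A).Nonempty) ∧
    (∀ i, (P i ∩ B).Nonempty) ∧ ∀ i j, i ≠ j → Disjoint (P i) (P j)

theorem Separates.symm {r : α → α → Prop} (hs : ∀ ⦃u v⦄, r u v → r v u) {A B S : Set α}
    (h : Separates r A B S) : Separates r B A S :=
  fun b hb hbS a ha haS hr => h a ha haS b hb hbS (hr.symm hs)

/-- Base case of Menger's theorem: without related pairs `A ∩ B` is itself a separator, so it has
`k` elements, and these are the linkage. -/
theorem linked_of_isEmpty {r : α → α → Prop} (hr : ∀ x y, ¬ r x y) {k : ℕ} {A B : Set α}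
    (hA : A.Finite) (h : ∀ S : Set α, S.Finite → Separates r A B S → k ≤ S.ncard) :
    Linked r k A B := by
  have hfin : (A ∩ B).Finite := hA.subset Set.inter_subset_left
  have hk : k ≤ (A ∩ B).ncard := by
    refine h _ hfin fun a ha haS b hb hbS hab => ?_
    rcases hab.eq_or_mem with rfl | ⟨u, hu⟩
    · exact haS ⟨ha, hb⟩
    · exact hr _ _ hu
  rw [Set.ncard_eq_toFinset_card _ hfin] at hk
  let e := hfin.toFinset.equivFin.symm
  let p : Fin k → α := fun i => (e (Fin.castLE hk i)).1
  have hp : ∀ i, p i ∈ A ∩ B := fun i => hfin.mem_toFinset.1 (e (Fin.castLE hk i)).2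
  have hinj : Function.Injective p := fun i j hij =>
    Fin.castLE_injective hk (e.injective (Subtype.ext hij))
  refine ⟨fun i => {p i}, fun i => ConnOn.singleton _, fun i => ⟨p i, rfl, (hp i).1⟩,
    fun i => ⟨p i, rfl, (hp i).2⟩, fun i j hij => ?_⟩
  simpa using fun h => hij (hinj h)

/-- Joining linkages on the two sides of a separator `S` of the graph without the edge `xy`. -/
theorem Linked.glue {r : α → α → Prop} (hs : ∀ ⦃u v⦄, r u v → r v u) {k : ℕ} {A B S L R : Set α} {x y : α}
    (hSfin : S.Finite) (hxS : x ∉ S) (hyS : y ∉ S) (hSk : S.ncard + 1 = k) (hxy : r x y)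
    (hLR : Disjoint L R)
    (hA : A ⊆ L ∪ S) (hB : B ⊆ R ∪ S)
    (h1 : Linked (fun u v => r u v ∧ u ∈ L ∪ S ∧ v ∈ L ∪ S) k A (insert x S))
    (h2 : Linked (fun u v => r u v ∧ u ∈ R ∪ S ∧ v ∈ R ∪ S) k (insert y S) B) :
    Linked r k A B := by
  obtain ⟨P, hPc, hPA, hPX, hPd⟩ := h1
  obtain ⟨Q, hQc, hQY, hQB, hQd⟩ := h2
  have hPsub : ∀ i, P i ⊆ L ∪ S := by
    intro i v hv
    obtain ⟨a, ha, haA⟩ := hPA i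
    rcases (hPc i a ha v hv).eq_or_mem with rfl | ⟨u, hu⟩
    · exact hA haA
    · exact hu.2.2
  have hQsub : ∀ i, Q i ⊆ R ∪ S := by
    intro i v hv
    obtain ⟨b, hb, hbB⟩ := hQB i
    rcases (hQc i b hb v hv).eq_or_mem with rfl | ⟨u, hu⟩
    · exact hB hbB
    · exact hu.2.2
  have hX : (insert x S).ncard = k := by rw [Set.ncard_insert_of_notMem hxS hSfin, hSk]
  have hY : (insert y S).ncard = k := by rw [Set.ncard_insert_of_notMem hyS hSfin, hSk]
  obtain ⟨p, hpP, hpX, -, hpu⟩ := exists_transversal (hSfin.insert x) hX hPd hPX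
  obtain ⟨q, hqQ, hqY, hqs, hqu⟩ := exists_transversal (hSfin.insert y) hY hQd hQY
  -- `P i` is continued by the `Q j` through the same vertex of `S`, or, if it ends in `x`, across
  -- the pair `xy` by the one through `y`.
  have hmatch : ∀ i, ∃ j, (p i ∈ S → q j = p i) ∧ (p i = x → q j = y) := by
    intro i
    rcases hpX i with h | h
    · obtain ⟨j, hj⟩ := hqs y (Set.mem_insert _ _)
      exact ⟨j, fun h' => absurd (h ▸ h') hxS, fun _ => hj⟩
    · obtain ⟨j, hj⟩ := hqs (p i) (Set.mem_insert_of_mem _ h)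
      exact ⟨j, fun _ => hj, fun h' => absurd (h' ▸ h) hxS⟩
  choose m hm1 hm2 using hmatch
  have hqm : ∀ i, q (m i) ∈ S → p i ∈ S := by
    intro i hi
    rcases hpX i with h | h
    · exact absurd (hm2 i h ▸ hi) hyS
    · exact h
  have hminj : ∀ i j, m i = m j → i = j := by
    intro i j hij
    have hpp : p i = p j := by
      rcases hpX i with h | h
      · rcases hpX j with h' | h'
        · rw [h, h']
        · have h3 := hm1 j h'
          rw [← hij, hm2 i h] at h3
          exact absurd (h3 ▸ h') hyS
      · have h3 := hm1 i h
        have h4 : p j ∈ S := hqm j (by rw [← hij, h3]; exact h)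
        rw [← h3, hij, hm1 j h4]
    by_contra hne
    exact Set.disjoint_left.1 (hPd i j hne) (hpP i) (hpp ▸ hpP j)
  -- The two linkages live on opposite sides, so they can meet only in `S`, where each set contains
  -- nothing but its transversal point.
  have hcross : ∀ i j, i ≠ j → Disjoint (P i) (Q (m j)) := by
    intro i j hij
    refine Set.disjoint_left.2 fun v hv hv' => ?_
    have hvS : v ∈ S := by
      rcases hPsub i hv with h | h
      · rcases hQsub _ hv' with h' | h'
        · exact absurd h' (Set.disjoint_left.1 hLR h)
        · exact h'
      · exact h
    have e1 := hpu i v (Set.mem_insert_of_mem _ hvS) hv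
    have e2 := hqu (m j) v (Set.mem_insert_of_mem _ hvS) hv'
    have e3 := hm1 j (hqm j (by rw [e2]; exact hvS))
    have : p i = p j := by rw [e1, ← e2, e3]
    exact Set.disjoint_left.1 (hPd i j hij) (hpP i) (this ▸ hpP j)
  refine ⟨fun i => P i ∪ Q (m i), fun i => ?_, fun i => ?_, fun i => ?_, fun i j hij => ?_⟩
  · refine ConnOn.union hs ((hPc i).mono fun u v _ _ h => h.1)
      ((hQc (m i)).mono fun u v _ _ h => h.1) (hpP i) (hqQ (m i)) ?_
    rcases hpX i with h | h
    · exact Or.inr (by rw [h, hm2 i h]; exact hxy)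
    · exact Or.inl (hm1 i h).symm
  · exact (hPA i).mono (Set.inter_subset_inter_left _ Set.subset_union_left)
  · exact (hQB (m i)).mono (Set.inter_subset_inter_left _ Set.subset_union_right)
  · rw [Set.disjoint_union_left, Set.disjoint_union_right, Set.disjoint_union_right]
    exact ⟨⟨hPd i j hij, hcross i j hij⟩, (hcross j i hij.symm).symm,
      hQd _ _ fun h => hij (hminj i j h)⟩

/-- If `S` separates `A` from `B` in `r'`, and `L` is the side of `A`, a separator of `A` from
`S + x` inside `L ∪ S` separates `A` from `B` in `r`, where `r` has the additional edge `xy`. -/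
theorem Separates.of_side {r r' : α → α → Prop} {A B S T L R : Set α} {x y : α}
    (hr : ∀ u v, r u v → r' u v ∨ (u = x ∧ v = y) ∨ (u = y ∧ v = x))
    (hA : A ⊆ L ∪ S) (hB : B ⊆ R ∪ S)
    (hLR : Disjoint L R) (hxL : x ∈ L) (hyL : y ∉ L)
    (hL : ∀ u ∈ L, ∀ v, v ∉ S → r' u v → v ∈ L)
    (hT : Separates (fun u v => r' u v ∧ u ∈ L ∪ S ∧ v ∈ L ∪ S) A (insert x S) T) :
    Separates r A B T := by
  intro a ha haT b hb hbT hab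
  by_cases haX : a ∈ insert x S
  · exact hT a ha haT a haX haT (Reach.refl _)
  have hbX : b ∈ S ∨ b ∉ L := by
    rcases hB hb with h | h
    · exact Or.inr fun h' => Set.disjoint_left.1 hLR h' h
    · exact Or.inl h
  have haL : a ∈ L := (hA ha).resolve_right fun h => haX (Set.mem_insert_of_mem _ h)
  -- Up to its first exit from `L \ (S + x)` the walk cannot use the additional pair, since `x` is
  -- excluded and `y ∉ L`; and the exit lands in `S + x`.
  obtain ⟨u, v, h1, h2, h3, h4, h5, h6⟩ :=
    hab.exists_exit (Q := L \ insert x S) ⟨haL, haX⟩ (by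
      rintro ⟨h, h'⟩
      rcases hbX with h'' | h''
      · exact h' (Set.mem_insert_of_mem _ h'')
      · exact h'' h)
  have hstep : ∀ u v, u ∈ L \ insert x S → r u v → v ∈ L ∪ S → r' u v := by
    intro u v hu huv hv
    rcases hr u v huv with h | ⟨rfl, -⟩ | ⟨rfl, -⟩
    · exact h
    · exact absurd (Set.mem_insert _ _) hu.2
    · exact absurd hu.1 hyL
  have hau : Reach (fun u v => r' u v ∧ u ∈ L ∪ S ∧ v ∈ L ∪ S) Tᶜ a u :=
    h1.mono (fun u v hu hv huv => ⟨hstep u v hu.2 huv (Or.inl hv.2.1), Or.inl hu.2.1,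
      Or.inl hv.2.1⟩) Set.inter_subset_left
  have huv : r' u v := by
    rcases hr u v h4 with h | ⟨rfl, -⟩ | ⟨rfl, -⟩
    · exact h
    · exact absurd (Set.mem_insert _ _) h2.2
    · exact absurd h2.1 hyL
  have hvX : v ∈ insert x S := by
    by_contra hvX
    exact h3 ⟨hL u h2.1 v (fun h => hvX (Set.mem_insert_of_mem _ h)) huv, hvX⟩
  have hvLS : v ∈ L ∪ S := by
    rcases hvX with rfl | h
    · exact Or.inl hxL
    · exact Or.inr h
  exact hT a ha haT v hvX h6 (hau.tail ⟨huv, Or.inl h2.1, hvLS⟩ h5 h6)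

/-- **Menger's theorem**, for a symmetric relation with finitely many related pairs. -/
theorem linked_of_forall_separates {r : α → α → Prop} (hs : ∀ ⦃u v⦄, r u v → r v u)
    (hfin : {p : α × α | r p.1 p.2}.Finite) {k : ℕ} {A B : Set α} (hA : A.Finite)
    (hB : B.Finite) (h : ∀ S : Set α, S.Finite → Separates r A B S → k ≤ S.ncard) :
    Linked r k A B := by
  induction hn : {p : α × α | r p.1 p.2}.ncard using Nat.strong_induction_on
    generalizing r A B with
  | _ n ih =>
  by_cases hempty : ∀ x y, ¬ r x y
  · exact linked_of_isEmpty hempty hA h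
  push Not at hempty
  obtain ⟨x₀, y₀, hxy₀⟩ := hempty
  set r' : α → α → Prop := fun u v => r u v ∧ ¬ (u = x₀ ∧ v = y₀) ∧ ¬ (u = y₀ ∧ v = x₀)
    with hr'
  have hs' : ∀ ⦃u v⦄, r' u v → r' v u := fun u v ⟨h1, h2, h3⟩ =>
    ⟨hs h1, fun h => h3 ⟨h.2, h.1⟩, fun h => h2 ⟨h.2, h.1⟩⟩
  have hsmall : ∀ q : α → α → Prop, (∀ u v, q u v → r' u v) →
      {p : α × α | q p.1 p.2}.Finite ∧ {p : α × α | q p.1 p.2}.ncard < n := by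
    intro q hq
    have hss : {p : α × α | q p.1 p.2} ⊂ {p : α × α | r p.1 p.2} := by
      refine ⟨fun p hp => (hq _ _ hp).1, fun hsub => ?_⟩
      have h0 : ((x₀, y₀) : α × α) ∈ {p : α × α | q p.1 p.2} := hsub hxy₀
      exact (hq _ _ h0).2.1 ⟨rfl, rfl⟩
    exact ⟨hfin.subset hss.1, hn ▸ Set.ncard_lt_ncard hss hfin⟩
  by_cases hsep : ∀ S : Set α, S.Finite → Separates r' A B S → k ≤ S.ncard
  · obtain ⟨P, hP, hP'⟩ := ih _ (hsmall r' fun _ _ h => h).2 hs' (hsmall r' fun _ _ h => h).1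
      hA hB hsep rfl
    exact ⟨P, fun i => (hP i).mono fun u v _ _ h => h.1, hP'⟩
  push Not at hsep
  obtain ⟨S, hSfin, hS, hSk⟩ := hsep
  set L : Set α := {v | v ∉ S ∧ ∃ a ∈ A, a ∉ S ∧ Reach r' Sᶜ a v} with hLdef
  set R : Set α := {v | v ∉ S ∧ ∃ b ∈ B, b ∉ S ∧ Reach r' Sᶜ b v} with hRdef
  have hLR : Disjoint L R := by
    refine Set.disjoint_left.2 ?_
    rintro v ⟨-, a, ha, haS, hav⟩ ⟨-, b, hb, hbS, hbv⟩
    exact hS a ha haS b hb hbS (hav.trans (hbv.symm hs'))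
  have hLcl : ∀ u ∈ L, ∀ v, v ∉ S → r' u v → v ∈ L := by
    rintro u ⟨hu, a, ha, haS, hau⟩ v hv huv
    exact ⟨hv, a, ha, haS, hau.tail huv hu hv⟩
  have hRcl : ∀ u ∈ R, ∀ v, v ∉ S → r' u v → v ∈ R := by
    rintro u ⟨hu, a, ha, haS, hau⟩ v hv huv
    exact ⟨hv, a, ha, haS, hau.tail huv hu hv⟩
  have hAL : A ⊆ L ∪ S := fun a ha => by
    by_cases haS : a ∈ S
    · exact Or.inr haS
    · exact Or.inl ⟨haS, a, ha, haS, Reach.refl _⟩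
  have hBR : B ⊆ R ∪ S := fun a ha => by
    by_cases haS : a ∈ S
    · exact Or.inr haS
    · exact Or.inl ⟨haS, a, ha, haS, Reach.refl _⟩
  have hnot : ¬ Separates r A B S := fun h' => by
    have := h S hSfin h'
    omega
  unfold Separates at hnot
  push Not at hnot
  obtain ⟨a, ha, haS, b, hb, hbS, hab⟩ := hnot
  have haL : a ∈ L := (hAL ha).resolve_right haS
  have hbR : b ∈ R := (hBR hb).resolve_right hbS
  -- `L` is closed under `r'` off `S`, so a walk avoiding `S` can leave `L` only along the deleted
  -- pair; this orients the pair as `x ∈ L`, `y ∉ L`.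
  obtain ⟨x, y, -, hxL, hyL, hxy, -, hyS⟩ :=
    hab.exists_exit haL fun h' => Set.disjoint_left.1 hLR h' hbR
  have hcase : (x = x₀ ∧ y = y₀) ∨ (x = y₀ ∧ y = x₀) := by
    by_contra hcon
    push Not at hcon
    exact hyL (hLcl x hxL y hyS ⟨hxy, fun h => hcon.1 h.1 h.2, fun h => hcon.2 h.1 h.2⟩)
  have hrr : ∀ u v, r u v → r' u v ∨ (u = x ∧ v = y) ∨ (u = y ∧ v = x) := by
    intro u v huv
    by_cases h' : r' u v
    · exact Or.inl h'
    · refine Or.inr ?_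
      have : (u = x₀ ∧ v = y₀) ∨ (u = y₀ ∧ v = x₀) := by
        by_contra hcon
        push Not at hcon
        exact h' ⟨huv, fun h => hcon.1 h.1 h.2, fun h => hcon.2 h.1 h.2⟩
      rcases hcase with ⟨rfl, rfl⟩ | ⟨rfl, rfl⟩
      · exact this
      · exact this.symm
  have hyR : y ∈ R := by
    obtain ⟨u, v, -, huR, hvR, huv, -, hvS⟩ :=
      (hab.symm hs).exists_exit hbR fun h' => Set.disjoint_left.1 hLR haL h'
    rcases hrr u v huv with h' | ⟨rfl, rfl⟩ | ⟨rfl, rfl⟩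
    · exact absurd (hRcl u huR v hvS h') hvR
    · exact absurd huR (Set.disjoint_left.1 hLR hxL)
    · exact huR
  have hxS : x ∉ S := hxL.1
  have hT1 : ∀ T : Set α, T.Finite →
      Separates (fun u v => r' u v ∧ u ∈ L ∪ S ∧ v ∈ L ∪ S) A (insert x S) T → k ≤ T.ncard :=
    fun T hTfin hT => h T hTfin (hT.of_side hrr hAL hBR hLR hxL hyL hLcl)
  have hT2 : ∀ T : Set α, T.Finite →
      Separates (fun u v => r' u v ∧ u ∈ R ∪ S ∧ v ∈ R ∪ S) (insert y S) B T → k ≤ T.ncard := by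
    intro T hTfin hT
    have hsR : ∀ ⦃u v⦄, (r' u v ∧ u ∈ R ∪ S ∧ v ∈ R ∪ S) → r' v u ∧ v ∈ R ∪ S ∧ u ∈ R ∪ S :=
      fun u v ⟨h1, h2, h3⟩ => ⟨hs' h1, h3, h2⟩
    refine h T hTfin (Separates.symm hs ((hT.symm hsR).of_side (x := y) (y := x)
      (fun u v huv => ?_) hBR hAL hLR.symm hyR (Set.disjoint_left.1 hLR hxL) hRcl))
    rcases hrr u v huv with h' | h' | h'
    · exact Or.inl h'
    · exact Or.inr (Or.inr h')
    · exact Or.inr (Or.inl h')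
  -- `S + x` separates `A` from `B` even in `r`, because it trivially separates `A` from itself on
  -- the side of `A`.
  have hSk1 : S.ncard + 1 = k := by
    have : Separates r A B (insert x S) := by
      refine Separates.of_side hrr hAL hBR hLR hxL hyL hLcl ?_
      exact fun _ _ _ b hb hbS => absurd hb hbS
    have := h _ (hSfin.insert x) this
    rw [Set.ncard_insert_of_notMem hxS hSfin] at this
    omega
  have hsub : ∀ W : Set α, ∀ u v, (r' u v ∧ u ∈ W ∧ v ∈ W) → r' u v := fun _ _ _ h => h.1
  have hsW : ∀ W : Set α, ∀ ⦃u v⦄, (r' u v ∧ u ∈ W ∧ v ∈ W) → r' v u ∧ v ∈ W ∧ u ∈ W :=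
    fun W u v ⟨h1, h2, h3⟩ => ⟨hs' h1, h3, h2⟩
  have l1 := ih _ (hsmall _ (hsub (L ∪ S))).2 (hsW _) (hsmall _ (hsub (L ∪ S))).1 hA
    (hSfin.insert x) hT1 rfl
  have l2 := ih _ (hsmall _ (hsub (R ∪ S))).2 (hsW _) (hsmall _ (hsub (R ∪ S))).1
    (hSfin.insert y) hB hT2 rfl
  have mono : ∀ {W C D : Set α}, Linked (fun u v => r' u v ∧ u ∈ W ∧ v ∈ W) k C D →
      Linked (fun u v => r u v ∧ u ∈ W ∧ v ∈ W) k C D :=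
    fun ⟨P, hP, hP'⟩ => ⟨P, fun i => (hP i).mono fun _ _ _ _ h => ⟨h.1.1, h.2⟩, hP'⟩
  exact Linked.glue hs hSfin hxS hyS hSk1 hxy hLR hAL hBR (mono l1) (mono l2)

end Menger

/-! ### Webs of branch sets indexed by a grid -/

/-- Adjacency in the infinite grid `ℕ × ℕ`. -/
def GAdj (u v : ℕ × ℕ) : Prop :=
  (u.1 = v.1 ∧ (u.2 + 1 = v.2 ∨ v.2 + 1 = u.2)) ∨ (u.2 = v.2 ∧ (u.1 + 1 = v.1 ∨ v.1 + 1 = u.1))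

/-- A family `N` of disjoint sets, indexed by the `n × n` grid, such that every nonempty `N v`
is either connected and joined to `N w` for every neighbour `w` of `v`, or all its
components meet `Z`. -/
structure Web {α : Type*} (n : ℕ) (r : α → α → Prop) (Z : Set α) (N : ℕ × ℕ → Set α) :
    Prop where
  symm : ∀ ⦃u v⦄, r u v → r v u
  disj : ∀ u v, u ≠ v → Disjoint (N u) (N v)
  good : ∀ v, v.1 < n → v.2 < n → (N v).Nonempty →
    (ConnOn r (N v) ∧ ∀ w, GAdj v w → w.1 < n → w.2 < n → ∃ x ∈ N v, ∃ y ∈ N w, r x y) ∨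
      ∀ x ∈ N v, ∃ z ∈ Z, Reach r (N v) x z

/-- All the sets indexed by the `i`-th row are nonempty. -/
def FullRow {α : Type*} (n : ℕ) (N : ℕ × ℕ → Set α) (i : ℕ) : Prop :=
  i < n ∧ ∀ j < n, (N (i, j)).Nonempty

/-- The elements outside `S` that `S` separates from `Z`. -/
def Unreached {α : Type*} (r : α → α → Prop) (Z S : Set α) : Set α :=
  {x | x ∉ S ∧ ∀ z ∈ Z, z ∉ S → ¬ Reach r Sᶜ z x}

/-- A web in which no set of fewer than `k` elements separates the `k`-element set `Z` from
a full row. -/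
structure Config {α : Type*} (n k : ℕ) (r : α → α → Prop) (Z : Set α) (N : ℕ × ℕ → Set α) : Prop
    extends Web n r Z N where
  pairs_finite : {p : α × α | r p.1 p.2}.Finite
  finite : Z.Finite
  card : Z.ncard = k
  row : ∃ i, FullRow n N i
  nosep : ∀ S : Set α, S.Finite → S.ncard < k → ∀ i, FullRow n N i →
    ¬ ∀ j < n, N (i, j) ⊆ S ∪ Unreached r Z S

/-- Some `g × g` subgrid, with branch sets disjoint from `Z`, has disjoint connected
enlargements `U i` of the first `k` branch sets of its first column that meet `Z`. -/
def HasRootedGrid {α : Type*} (n g k : ℕ) (r : α → α → Prop) (Z : Set α) (N : ℕ × ℕ → Set α) :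
    Prop :=
  ∃ a b, a + g ≤ n ∧ b + g ≤ n ∧
    (∀ i < g, ∀ j < g, (N (a + i, b + j)).Nonempty ∧ Disjoint (N (a + i, b + j)) Z) ∧
    ∃ U : ℕ → Set α,
      (∀ i < k, N (a + i, b) ⊆ U i ∧ ConnOn r (U i) ∧ (U i ∩ Z).Nonempty) ∧
      (∀ i < k, ∀ i' < k, i ≠ i' → Disjoint (U i) (U i')) ∧
      ∀ i < k, ∀ i' < g, ∀ j < g, ¬ (i' = i ∧ j = 0) → Disjoint (U i) (N (a + i', b + j))

section Cut

variable {α : Type*} {n k g : ℕ} {r : α → α → Prop} {Z S : Set α} {N : ℕ × ℕ → Set α}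

/-- `N v` is nonempty and separated from `Z` by `S`. -/
def IsCut (r : α → α → Prop) (Z : Set α) (N : ℕ × ℕ → Set α) (S : Set α) (v : ℕ × ℕ) : Prop :=
  (N v).Nonempty ∧ N v ⊆ Unreached r Z S

theorem IsCut.disjoint {v : ℕ × ℕ} (h : IsCut r Z N S v) : Disjoint (N v) Z :=
  Set.disjoint_left.2 fun x hx hxZ => (h.2 hx).2 x hxZ (h.2 hx).1 (Reach.refl _)

theorem mem_unreached_of_reach (hs : ∀ ⦃u v⦄, r u v → r v u) {x y : α} (hx : x ∈ Unreached r Z S)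
    (h : Reach r Sᶜ x y) : y ∈ Unreached r Z S :=
  ⟨h.mem hx.1, fun z hz hzS hzy => hx.2 z hz hzS (hzy.trans (h.symm hs))⟩

/-- If every component of `N v` met `Z`, then `x` would be reached from `Z` inside `N v`, which
avoids `S`. So `N v` is connected, and one unreached vertex decides for all. -/
theorem Web.isCut_of_mem (c : Web n r Z N) {v : ℕ × ℕ} (h1 : v.1 < n) (h2 : v.2 < n)
    (hvS : Disjoint (N v) S) {x : α} (hx : x ∈ N v) (hxU : x ∈ Unreached r Z S) :
    IsCut r Z N S v := by
  have hsub : N v ⊆ Sᶜ := fun y hy => Set.disjoint_left.1 hvS hy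
  refine ⟨⟨x, hx⟩, fun y hy => ?_⟩
  rcases c.good v h1 h2 ⟨x, hx⟩ with ⟨h, -⟩ | h
  · exact mem_unreached_of_reach c.symm hxU ((h x hx y hy).mono_set hsub)
  · obtain ⟨z, hz, hxz⟩ := h x hx
    exact absurd (Reach.refl z)
      ((mem_unreached_of_reach c.symm hxU (hxz.mono_set hsub)).2 z hz (hsub (hxz.mem hx)))

theorem Web.conn_of_disjoint (c : Web n r Z N) {v : ℕ × ℕ} (h1 : v.1 < n) (h2 : v.2 < n)
    (hne : (N v).Nonempty) (hvZ : Disjoint (N v) Z) :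
    ConnOn r (N v) ∧ ∀ w, GAdj v w → w.1 < n → w.2 < n → ∃ x ∈ N v, ∃ y ∈ N w, r x y := by
  rcases c.good v h1 h2 hne with h | h
  · exact h
  · obtain ⟨x, hx⟩ := hne
    obtain ⟨z, hz, hxz⟩ := h x hx
    exact absurd hz (Set.disjoint_left.1 hvZ (hxz.mem hx))

/-- The propagation step. It also yields that `N w` is nonempty, which is how complete subgrids are
found from a single row. -/
theorem Web.isCut_step (c : Web n r Z N) {v w : ℕ × ℕ} (hv : IsCut r Z N S v) (hvw : GAdj v w)
    (hv1 : v.1 < n) (hv2 : v.2 < n) (hw1 : w.1 < n) (hw2 : w.2 < n) (hwS : Disjoint (N w) S) :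
    IsCut r Z N S w := by
  obtain ⟨x, hx, y, hy, hxy⟩ := (c.conn_of_disjoint hv1 hv2 hv.1 hv.disjoint).2 w hvw hw1 hw2
  have hyS : y ∉ S := Set.disjoint_left.1 hwS hy
  exact c.isCut_of_mem hw1 hw2 hwS hy
    (mem_unreached_of_reach c.symm (hv.2 hx) (Reach.single hxy (hv.2 hx).1 hyS))

theorem Web.isCut_row (c : Web n r Z N) {i j j' : ℕ} (h : IsCut r Z N S (i, j)) (hi : i < n)
    (hj : j < n) (hj' : j' < n)
    (hS : ∀ m, min j j' ≤ m → m ≤ max j j' → Disjoint (N (i, m)) S) :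
    IsCut r Z N S (i, j') := by
  have up : ∀ d, j + d ≤ j' → IsCut r Z N S (i, j + d) := by
    intro d
    induction d with
    | zero => exact fun _ => h
    | succ d ih =>
      intro hd
      exact c.isCut_step (ih (by omega)) (by simp [GAdj]; omega) hi (by simp; omega) hi
        (by simp; omega) (hS _ (by omega) (by omega))
  have down : ∀ d, j' + d ≤ j → IsCut r Z N S (i, j - d) := by
    intro d
    induction d with
    | zero => exact fun _ => h
    | succ d ih =>
      intro hd
      exact c.isCut_step (ih (by omega)) (by simp [GAdj]; omega) hi (by simp; omega) hi
        (by simp; omega) (hS _ (by omega) (by omega))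
  rcases le_total j j' with hjj | hjj
  · have := up (j' - j) (by omega)
    rwa [show j + (j' - j) = j' by omega] at this
  · have := down (j - j') (by omega)
    rwa [show j - (j - j') = j' by omega] at this

theorem Web.isCut_col (c : Web n r Z N) {i i' j : ℕ} (h : IsCut r Z N S (i, j)) (hj : j < n)
    (hi : i < n) (hi' : i' < n)
    (hS : ∀ m, min i i' ≤ m → m ≤ max i i' → Disjoint (N (m, j)) S) :
    IsCut r Z N S (i', j) := by
  have up : ∀ d, i + d ≤ i' → IsCut r Z N S (i + d, j) := by
    intro d
    induction d with
    | zero => exact fun _ => h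
    | succ d ih =>
      intro hd
      exact c.isCut_step (ih (by omega)) (by simp [GAdj]; omega) (by simp; omega) hj
        (by simp; omega) hj (hS _ (by omega) (by omega))
  have down : ∀ d, i' + d ≤ i → IsCut r Z N S (i - d, j) := by
    intro d
    induction d with
    | zero => exact fun _ => h
    | succ d ih =>
      intro hd
      exact c.isCut_step (ih (by omega)) (by simp [GAdj]; omega) (by simp; omega) hj
        (by simp; omega) hj (hS _ (by omega) (by omega))
  rcases le_total i i' with hii | hii
  · have := up (i' - i) (by omega)
    rwa [show i + (i' - i) = i' by omega] at this
  · have := down (i - i') (by omega)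
    rwa [show i - (i - i') = i' by omega] at this

/-- Among `k` columns starting at column `b`, one avoids `S`. -/
theorem Web.exists_col_disjoint (c : Web n r Z N) (hS : S.Finite) (hk : S.ncard < k) (b : ℕ) :
    ∃ j < k, ∀ i, Disjoint (N (i, b + j)) S := by
  obtain ⟨j, hj, h⟩ := exists_disjoint_of_ncard_lt hS hk (fun j => ⋃ i, N (i, b + j)) (by
    intro j _ j' _ hjj
    simp only [Set.disjoint_iUnion_left, Set.disjoint_iUnion_right]
    exact fun i i' => c.disj _ _ (by simp; omega))
  exact ⟨j, hj, by simpa using h⟩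

/-- Among `k` rows starting at row `a`, one avoids `S`. -/
theorem Web.exists_row_disjoint (c : Web n r Z N) (hS : S.Finite) (hk : S.ncard < k) (a : ℕ) :
    ∃ i < k, ∀ j, Disjoint (N (a + i, j)) S := by
  obtain ⟨j, hj, h⟩ := exists_disjoint_of_ncard_lt hS hk (fun i => ⋃ j, N (a + i, j)) (by
    intro j _ j' _ hjj
    simp only [Set.disjoint_iUnion_left, Set.disjoint_iUnion_right]
    exact fun i i' => c.disj _ _ (by simp; omega))
  exact ⟨j, hj, by simpa using h⟩

/-- If a branch set in an `S`-avoiding column is cut off from `Z` by a small set `S`, then so is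
some full row. -/
theorem Web.exists_row_isCut (c : Web n r Z N) (hS : S.Finite) (hk : S.ncard < k) (hkn : k ≤ n)
    {i j : ℕ} (hi : i < n) (hj : j < n) (h : IsCut r Z N S (i, j))
    (hcol : ∀ m, Disjoint (N (m, j)) S) :
    ∃ i' < n, ∀ j' < n, IsCut r Z N S (i', j') := by
  obtain ⟨i', hi', hrow⟩ := c.exists_row_disjoint hS hk 0
  rw [zero_add] at hrow
  have hi'n : i' < n := by omega
  have h' := c.isCut_col h hj hi hi'n fun m _ _ => hcol m
  exact ⟨i', hi'n, fun j' hj' => c.isCut_row h' hi'n hj hj' fun m _ _ => hrow m⟩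

/-- Propagation turns the cut set into a full row cut off by fewer than `k` elements, which `nosep`
forbids. -/
theorem Config.not_isCut (c : Config n k r Z N) (hS : S.Finite) (hk : S.ncard < k) (hkn : k ≤ n)
    {i j : ℕ} (hi : i < n) (hj : j < n) (hcol : ∀ m, Disjoint (N (m, j)) S) :
    ¬ IsCut r Z N S (i, j) := by
  intro h
  obtain ⟨i', hi', h'⟩ := c.exists_row_isCut hS hk hkn hi hj h hcol
  exact c.nosep S hS hk i' ⟨hi', fun j' hj' => (h' j' hj').1⟩ fun j' hj' =>
    (h' j' hj').2.trans Set.subset_union_right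

end Cut

/-! ### Restricting to one side of a separation -/

section Restrict

variable {α : Type*} {n k g : ℕ} {r : α → α → Prop} {Z Z' W : Set α} {N : ℕ × ℕ → Set α}

/-- By `hcl` a step out of `W` can start only in `Z'`, so the first vertex of the walk outside `W \
Z'` is still in `W` and belongs to `Z'`. -/
theorem Reach.exists_reach_restrict (hs : ∀ ⦃u v⦄, r u v → r v u)
    (hcl : ∀ u, u ∉ W → ∀ w ∈ W, r u w → w ∈ Z') {P : Set α}
    {x y : α} (h : Reach r P x y) (hx : x ∈ W) (hy : y ∈ W → y ∈ Z') :
    ∃ z ∈ Z', Reach (fun u v => r u v ∧ u ∈ W ∧ v ∈ W) (P ∩ W) x z := by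
  by_cases hxZ : x ∈ Z'
  · exact ⟨x, hxZ, Reach.refl _⟩
  obtain ⟨u, v, h1, h2, h3, h4, h5, h6⟩ :=
    h.exists_exit (Q := W \ Z') ⟨hx, hxZ⟩ fun h => h.2 (hy h.1)
  have hvW : v ∈ W := by
    by_contra hvW
    exact h2.2 (hcl v hvW u h2.1 (hs h4))
  have hvZ : v ∈ Z' := by
    by_contra hvZ
    exact h3 ⟨hvW, hvZ⟩
  refine ⟨v, hvZ, Reach.tail (h1.mono (fun a b ha hb hab => ⟨hab, ha.2.1, hb.2.1⟩) ?_)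
    ⟨h4, h2.1, hvW⟩ ⟨h5, h2.1⟩ ⟨h6, hvW⟩⟩
  exact fun a ha => ⟨ha.1, ha.2.1⟩

theorem Web.subset_of_restrict (c : Web n r Z N)
    (hcl : ∀ u, u ∉ W → ∀ w ∈ W, r u w → w ∈ Z') (hZW : ∀ z ∈ Z, z ∈ W → z ∈ Z')
    {v : ℕ × ℕ} (h1 : v.1 < n) (h2 : v.2 < n) (hne : (N v ∩ W).Nonempty)
    (hd : Disjoint (N v ∩ W) Z') : N v ⊆ W := by
  obtain ⟨x, hx, hxW⟩ := hne
  have key : ∀ y, Reach r (N v) x y → (y ∈ W → y ∈ Z') → False := by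
    intro y hxy hy
    obtain ⟨z, hz, hxz⟩ := hxy.exists_reach_restrict c.symm hcl hxW hy
    exact Set.disjoint_left.1 hd (hxz.mem ⟨hx, hxW⟩) hz
  intro y hy
  by_contra hyW
  rcases c.good v h1 h2 ⟨x, hx⟩ with ⟨h, -⟩ | h
  · exact key y (h x hx y hy) fun h => absurd h hyW
  · obtain ⟨z, hz, hxz⟩ := h x hx
    exact key z hxz (hZW z hz)

theorem Web.restrict (c : Web n r Z N)
    (hcl : ∀ u, u ∉ W → ∀ w ∈ W, r u w → w ∈ Z') (hZW : ∀ z ∈ Z, z ∈ W → z ∈ Z') :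
    Web n (fun u v => r u v ∧ u ∈ W ∧ v ∈ W) Z' (fun v => N v ∩ W) where
  symm := fun u v ⟨h1, h2, h3⟩ => ⟨c.symm h1, h3, h2⟩
  disj := fun u v huv => (c.disj u v huv).mono Set.inter_subset_left Set.inter_subset_left
  good := by
    intro v h1 h2 hne
    have hne' : (N v).Nonempty := hne.mono Set.inter_subset_left
    -- Either `N v` leaves `W \ Z'`, and then walks inside it from points of `W` run into `Z'`; or
    -- `N v` is untouched by the truncation.
    by_cases hex : ∃ y ∈ N v, y ∈ W → y ∈ Z'
    · right
      rintro x ⟨hx, hxW⟩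
      rcases c.good v h1 h2 hne' with ⟨h, -⟩ | h
      · obtain ⟨y, hy, hyW⟩ := hex
        exact (h x hx y hy).exists_reach_restrict c.symm hcl hxW hyW
      · obtain ⟨z, hz, hxz⟩ := h x hx
        exact hxz.exists_reach_restrict c.symm hcl hxW (hZW z hz)
    · push Not at hex
      have hsub : N v ∩ W = N v := Set.inter_eq_left.2 fun y hy => (hex y hy).1
      rcases c.good v h1 h2 hne' with ⟨h, h'⟩ | h
      · left
        simp only [hsub]
        refine ⟨h.mono fun a b ha hb hab => ⟨hab, (hex a ha).1, (hex b hb).1⟩, ?_⟩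
        intro w hvw hw1 hw2
        obtain ⟨x, hx, y, hy, hxy⟩ := h' w hvw hw1 hw2
        have hyW : y ∈ W := by
          by_contra hyW
          exact (hex x hx).2 (hcl y hyW x (hex x hx).1 (c.symm hxy))
        exact ⟨x, hx, y, ⟨hy, hyW⟩, hxy, (hex x hx).1, hyW⟩
      · obtain ⟨x, hx⟩ := hne'
        obtain ⟨z, hz, hxz⟩ := h x hx
        have := hex z (hxz.mem hx)
        exact absurd (hZW z hz this.1) this.2

/-- A full row of truncated sets may lie only partly in `W`, so `nosep` for `c` says nothing about
it directly. Propagation replaces it by a row that is entirely cut off, hence misses `Z'`, hence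
lies in `W`. Walks from `Z` to that row must pass `Z'`, so `S` cuts it off from `Z` as well. -/
theorem Config.restrict (c : Config n k r Z N) (hkn : k ≤ n)
    (hfin : Z'.Finite) (hcard : Z'.ncard = k)
    (hcl : ∀ u, u ∉ W → ∀ w ∈ W, r u w → w ∈ Z') (hZW : ∀ z ∈ Z, z ∈ W → z ∈ Z')
    {i₀ : ℕ} (hrow : FullRow n N i₀) (hrowW : ∀ j < n, N (i₀, j) ⊆ W) :
    Config n k (fun u v => r u v ∧ u ∈ W ∧ v ∈ W) Z' (fun v => N v ∩ W) := by
  have w := c.toWeb.restrict hcl hZW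
  refine { w with
    pairs_finite := c.pairs_finite.subset fun p hp => hp.1
    finite := hfin
    card := hcard
    row := ⟨i₀, hrow.1, fun j hj => ?_⟩
    nosep := ?_ }
  · simpa only [Set.inter_eq_left.2 (hrowW j hj)] using hrow.2 j hj
  intro S hS hSk i hi hcut
  obtain ⟨j, hj, hcol⟩ := w.exists_col_disjoint hS hSk 0
  rw [zero_add] at hcol
  have hjn : j < n := by omega
  have h0 : IsCut (fun u v => r u v ∧ u ∈ W ∧ v ∈ W) Z' (fun v => N v ∩ W) S (i, j) := by
    refine ⟨hi.2 j hjn, fun x hx => ?_⟩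
    exact (hcut j hjn hx).resolve_left (Set.disjoint_left.1 (hcol i) hx)
  obtain ⟨i', hi', h'⟩ := w.exists_row_isCut hS hSk hkn hi.1 hjn h0 hcol
  refine c.nosep S hS hSk i' ⟨hi', fun j' hj' => (h' j' hj').1.mono Set.inter_subset_left⟩ ?_
  intro j' hj' x hx
  have hxW : x ∈ W := c.subset_of_restrict hcl hZW (v := (i', j')) hi' hj' (h' j' hj').1
    (h' j' hj').disjoint hx
  have hxU := (h' j' hj').2 ⟨hx, hxW⟩
  refine Or.inr ⟨hxU.1, fun z hz hzS hzx => ?_⟩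
  obtain ⟨z', hz', hxz'⟩ :=
    (hzx.symm c.symm).exists_reach_restrict c.symm hcl hxW (hZW z hz)
  exact hxU.2 z' hz' (hxz'.mem (P := Sᶜ ∩ W) ⟨hxU.1, hxW⟩).1
    ((hxz'.symm w.symm).mono_set Set.inter_subset_left)

/-- The two sides of the separation are linked. -/
theorem Config.linked_of_restrict (c : Config n k r Z N) (hfin : Z'.Finite)
    (hcl : ∀ u, u ∉ W → ∀ w ∈ W, r u w → w ∈ Z') (hZW : ∀ z ∈ Z, z ∈ W → z ∈ Z')
    {i₀ : ℕ} (hrow : FullRow n N i₀) (hrowW : ∀ j < n, N (i₀, j) ⊆ W) :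
    Linked (fun u v => r u v ∧ u ∈ Wᶜ ∪ Z' ∧ v ∈ Wᶜ ∪ Z') k Z Z' := by
  refine linked_of_forall_separates (fun u v ⟨h1, h2, h3⟩ => ⟨c.symm h1, h3, h2⟩)
    (c.pairs_finite.subset fun p hp => hp.1) c.finite hfin fun S hS hsep => ?_
  by_contra hlt
  -- A separator of `Z` from `Z'` on the near side also separates `Z` from row `i₀`, which lies in
  -- `W`.
  refine c.nosep S hS (not_le.1 hlt) i₀ hrow fun j hj x hx => ?_
  by_cases hxS : x ∈ S
  · exact Or.inl hxS
  refine Or.inr ⟨hxS, fun z hz hzS hzx => ?_⟩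
  have hxW := hrowW j hj hx
  by_cases hzW : z ∈ W
  · exact hsep z hz hzS z (hZW z hz hzW) hzS (Reach.refl _)
  obtain ⟨u, v, h1, h2, h3, h4, h5, h6⟩ := hzx.exists_exit (Q := Wᶜ) hzW fun h => h hxW
  have hvZ : v ∈ Z' := hcl u h2 v (not_not.1 h3) h4
  refine hsep z hz hzS v hvZ h6 (Reach.tail (h1.mono (fun a b ha hb hab =>
    ⟨hab, Or.inl ha.2, Or.inl hb.2⟩) Set.inter_subset_left) ⟨h4, Or.inl h2, Or.inr hvZ⟩ h5 h6)

/-- A linking set `P l` meets `W` only in its single point of `Z'`. Attached to the `U i` containing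
that point, it creates no new intersection inside `W`. -/
theorem Config.hasRootedGrid_of_restrict (c : Config n k r Z N) (hk : 0 < k) (hkg : k ≤ g)
    (hZ'W : Z' ⊆ W) (hfin : Z'.Finite) (hcard : Z'.ncard = k)
    (hcl : ∀ u, u ∉ W → ∀ w ∈ W, r u w → w ∈ Z') (hZW : ∀ z ∈ Z, z ∈ W → z ∈ Z')
    {i₀ : ℕ} (hrow : FullRow n N i₀) (hrowW : ∀ j < n, N (i₀, j) ⊆ W)
    (h : HasRootedGrid n g k (fun u v => r u v ∧ u ∈ W ∧ v ∈ W) Z' (fun v => N v ∩ W)) :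
    HasRootedGrid n g k r Z N := by
  obtain ⟨P, hPc, hPZ, hPZ', hPd⟩ := c.linked_of_restrict hfin hcl hZW hrow hrowW
  obtain ⟨p, hpP, hpZ, hps, hpu⟩ := exists_transversal hfin hcard hPd hPZ'
  have hPsub : ∀ i x, x ∈ P i → x ∈ W → x ∈ Z' := by
    intro i x hx hxW
    rcases (hPc i (p i) (hpP i) x hx).eq_or_mem with h | ⟨u, hu⟩
    · exact h ▸ hpZ i
    · exact hu.2.2.resolve_left fun h => h hxW
  obtain ⟨a, b, ha, hb, hN, U, hU, hUd, hUN⟩ := h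
  beta_reduce at hN hU hUN
  have hsub : ∀ i < g, ∀ j < g, N (a + i, b + j) ⊆ W := fun i hi j hj =>
    c.subset_of_restrict hcl hZW (v := (a + i, b + j)) (by simp; omega) (by simp; omega)
      (hN i hi j hj).1 (hN i hi j hj).2
  have hNW : ∀ i < g, ∀ j < g, N (a + i, b + j) ∩ W = N (a + i, b + j) :=
    fun i hi j hj => Set.inter_eq_left.2 (hsub i hi j hj)
  have hUW : ∀ i < k, U i ⊆ W := by
    intro i hi x hx
    obtain ⟨-, h2, z, hzU, hzZ⟩ := hU i hi
    rcases (h2 z hzU x hx).eq_or_mem with h | ⟨u, hu⟩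
    · exact h ▸ hZ'W hzZ
    · exact hu.2.2
  have hm : ∀ i, ∃ m : Fin k, i < k → p m ∈ U i := by
    intro i
    by_cases hi : i < k
    · obtain ⟨z, hzU, hzZ⟩ := (hU i hi).2.2
      obtain ⟨m, hm⟩ := hps z hzZ
      exact ⟨m, fun _ => hm ▸ hzU⟩
    · exact ⟨⟨0, hk⟩, fun h => absurd h hi⟩
  choose m hm using hm
  have hUP : ∀ i < k, ∀ A : Set α, A ⊆ W → Disjoint (U i) A → Disjoint (P (m i)) A := by
    intro i hi A hA hd
    refine Set.disjoint_left.2 fun x hx hxA => ?_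
    have := hpu (m i) x (hPsub _ x hx (hA hxA)) hx
    exact Set.disjoint_left.1 hd (this ▸ hm i hi) hxA
  refine ⟨a, b, ha, hb, fun i hi j hj => ⟨(hN i hi j hj).1.mono Set.inter_subset_left, ?_⟩,
    fun i => U i ∪ P (m i), fun i hi => ⟨?_, ?_, ?_⟩, fun i hi i' hi' hii => ?_,
    fun i hi i' hi' j hj hne => ?_⟩
  · refine Set.disjoint_left.2 fun x hx hxZ => ?_
    have hxW := hsub i hi j hj hx
    exact Set.disjoint_left.1 (hN i hi j hj).2 ⟨hx, hxW⟩ (hZW x hxZ hxW)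
  · have := hNW i (by omega) 0 (by omega)
    rw [add_zero] at this
    exact (this ▸ (hU i hi).1).trans Set.subset_union_left
  · exact ConnOn.union c.symm ((hU i hi).2.1.mono fun _ _ _ _ h => h.1)
      ((hPc (m i)).mono fun _ _ _ _ h => h.1) (hm i hi) (hpP (m i)) (Or.inl rfl)
  · exact (hPZ (m i)).mono (Set.inter_subset_inter_left _ Set.subset_union_right)
  · have hd := hUd i hi i' hi' hii
    have hmm : m i ≠ m i' := fun h =>
      Set.disjoint_left.1 hd (hm i hi) (h ▸ hm i' hi')
    rw [Set.disjoint_union_left, Set.disjoint_union_right, Set.disjoint_union_right]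
    exact ⟨⟨hd, (hUP i' hi' _ (hUW i hi) hd.symm).symm⟩, hUP i hi _ (hUW i' hi') hd,
      hPd _ _ hmm⟩
  · have hd := hUN i hi i' hi' j hj hne
    rw [hNW i' hi' j hj] at hd
    rw [Set.disjoint_union_left]
    exact ⟨hd, hUP i hi _ (hsub i' hi' j hj) hd⟩

end Restrict

/-! ### Reduction to tight configurations -/

section Tight

variable {α : Type*} {n k g : ℕ}

/-- Every `r`-related pair lies in one branch set or in two neighbouring branch sets. -/
def IsTight (n : ℕ) (r : α → α → Prop) (N : ℕ × ℕ → Set α) : Prop :=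
  ∀ x y, r x y → ∃ u v : ℕ × ℕ, u.1 < n ∧ u.2 < n ∧ v.1 < n ∧ v.2 < n ∧ x ∈ N u ∧ y ∈ N v ∧
    (u = v ∨ GAdj u v)

theorem GAdj.symm {u v : ℕ × ℕ} (h : GAdj u v) : GAdj v u := by
  unfold GAdj at *
  omega

theorem Config.hasRootedGrid (hk : 0 < k) (hkg : k ≤ g) (hkn : k ≤ n)
    (tight : ∀ (r : α → α → Prop) (Z : Set α) (N : ℕ × ℕ → Set α), Config n k r Z N →
      IsTight n r N → HasRootedGrid n g k r Z N)
    {r : α → α → Prop} {Z : Set α} {N : ℕ × ℕ → Set α} (c : Config n k r Z N) :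
    HasRootedGrid n g k r Z N := by
  induction hn : {p : α × α | r p.1 p.2}.ncard using Nat.strong_induction_on
    generalizing r Z N with
  | _ l ih =>
  by_cases ht : IsTight n r N
  · exact tight r Z N c ht
  unfold IsTight at ht
  push Not at ht
  obtain ⟨x₀, y₀, hxy₀, hun⟩ := ht
  set r' : α → α → Prop := fun u v => r u v ∧ ¬ (u = x₀ ∧ v = y₀) ∧ ¬ (u = y₀ ∧ v = x₀)
    with hr'
  have hr'r : ∀ u v, r' u v → r u v := fun _ _ h => h.1
  have hs' : ∀ ⦃u v⦄, r' u v → r' v u := fun u v ⟨h1, h2, h3⟩ =>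
    ⟨c.symm h1, fun h => h3 ⟨h.2, h.1⟩, fun h => h2 ⟨h.2, h.1⟩⟩
  have hsmall : ∀ q : α → α → Prop, (∀ u v, q u v → r u v) → ¬ q x₀ y₀ →
      {p : α × α | q p.1 p.2}.ncard < l := by
    intro q hq hq'
    exact hn ▸ Set.ncard_lt_ncard ⟨fun p hp => hq _ _ hp,
      fun hsub => hq' (hsub (show ((x₀, y₀) : α × α) ∈ _ from hxy₀))⟩ c.pairs_finite
  have hkeep : ∀ u v : ℕ × ℕ, u.1 < n → u.2 < n → v.1 < n → v.2 < n → (u = v ∨ GAdj u v) →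
      ∀ x ∈ N u, ∀ y ∈ N v, r x y → r' x y := by
    intro u v hu1 hu2 hv1 hv2 huv x hx y hy hxy
    refine ⟨hxy, ?_, ?_⟩
    · rintro ⟨rfl, rfl⟩
      have := hun u v hu1 hu2 hv1 hv2 hx hy
      exact huv.elim this.1 this.2
    · rintro ⟨rfl, rfl⟩
      have := hun v u hv1 hv2 hu1 hu2 hy hx
      exact huv.elim (fun h => this.1 h.symm) fun h => this.2 h.symm
  have w' : Web n r' Z N := by
    refine ⟨hs', c.disj, fun v hv1 hv2 hne => ?_⟩
    have hin := fun x hx y hy => hkeep v v hv1 hv2 hv1 hv2 (Or.inl rfl) x hx y hy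
    rcases c.good v hv1 hv2 hne with ⟨h, h'⟩ | h
    · refine Or.inl ⟨h.mono fun x y hx hy => hin x hx y hy, fun w hvw hw1 hw2 => ?_⟩
      obtain ⟨x, hx, y, hy, hxy⟩ := h' w hvw hw1 hw2
      exact ⟨x, hx, y, hy, hkeep v w hv1 hv2 hw1 hw2 (Or.inr hvw) x hx y hy hxy⟩
    · refine Or.inr fun x hx => ?_
      obtain ⟨z, hz, hxz⟩ := h x hx
      exact ⟨z, hz, hxz.mono (fun x y hx hy => hin x hx y hy) subset_rfl⟩
  by_cases hno : ∀ S : Set α, S.Finite → S.ncard < k → ∀ i, FullRow n N i →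
      ¬ ∀ j < n, N (i, j) ⊆ S ∪ Unreached r' Z S
  · have c' : Config n k r' Z N := { w' with
      pairs_finite := c.pairs_finite.subset fun p hp => hp.1
      finite := c.finite
      card := c.card
      row := c.row
      nosep := hno }
    obtain ⟨a, b, ha, hb, hN, U, hU, hU'⟩ :=
      ih _ (hsmall r' hr'r fun h => h.2.1 ⟨rfl, rfl⟩) c' rfl
    exact ⟨a, b, ha, hb, hN, U, fun i hi => ⟨(hU i hi).1,
      (hU i hi).2.1.mono fun _ _ _ _ h => h.1, (hU i hi).2.2⟩, hU'⟩
  push Not at hno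
  obtain ⟨S, hS, hSk, i, hi, hcut⟩ := hno
  -- `L` is the near side after deletion of the pair; the induction continues on `W = Lᶜ`.
  set L : Set α := {v | v ∉ S ∧ ∃ z ∈ Z, z ∉ S ∧ Reach r' Sᶜ z v} with hL
  have hrowL : ∀ j < n, N (i, j) ⊆ Lᶜ := by
    rintro j hj x hx ⟨hxS, z, hz, hzS, hzx⟩
    exact ((hcut j hj hx).resolve_left hxS).2 z hz hzS hzx
  have hZL : ∀ z ∈ Z, z ∉ S → z ∈ L := fun z hz hzS => ⟨hzS, z, hz, hzS, Reach.refl _⟩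
  have hcl' : ∀ u ∈ L, ∀ v, v ∉ S → r' u v → v ∈ L := by
    rintro u ⟨hu, z, hz, hzS, hzu⟩ v hv huv
    exact ⟨hv, z, hz, hzS, hzu.tail huv hu hv⟩
  -- `S` does not separate in `r`, so some step leaves `L` off `S`. It is the deleted pair, and its
  -- far end `q` completes `S` to the new root set.
  obtain ⟨p, q, hpL, hqL, hpq, hqS⟩ : ∃ p q, p ∈ L ∧ q ∉ L ∧ r p q ∧ q ∉ S := by
    have := c.nosep S hS hSk i hi
    push Not at this
    obtain ⟨j, hj, hj'⟩ := this
    obtain ⟨x, hx, hxU⟩ := Set.not_subset.1 hj'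
    have hxS : x ∉ S := fun h => hxU (Or.inl h)
    have : ∃ z ∈ Z, z ∉ S ∧ Reach r Sᶜ z x := by
      by_contra! hcon
      exact hxU (Or.inr ⟨hxS, hcon⟩)
    obtain ⟨z, hz, hzS, hzx⟩ := this
    obtain ⟨u, v, -, h2, h3, h4, -, h6⟩ := hzx.exists_exit (hZL z hz hzS) (hrowL j hj hx)
    exact ⟨u, v, h2, h3, h4, h6⟩
  have hpair : ∀ u ∈ L, ∀ v, v ∉ L → v ∉ S → r u v → (u = x₀ ∧ v = y₀) ∨ (u = y₀ ∧ v = x₀) := by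
    intro u hu v hv hvS huv
    by_contra hcon
    push Not at hcon
    exact hv (hcl' u hu v hvS ⟨huv, fun h => hcon.1 h.1 h.2, fun h => hcon.2 h.1 h.2⟩)
  have hcl : ∀ u, u ∉ Lᶜ → ∀ w ∈ Lᶜ, r u w → w ∈ insert q S := by
    intro u hu w hw huw
    by_cases hwS : w ∈ S
    · exact Set.mem_insert_of_mem _ hwS
    rw [Set.notMem_compl_iff] at hu
    have e1 := hpair u hu w hw hwS huw
    have e2 := hpair p hpL q hqL hqS hpq
    have hwq : w = q := by
      rcases e1 with ⟨rfl, rfl⟩ | ⟨rfl, rfl⟩ <;> rcases e2 with ⟨rfl, rfl⟩ | ⟨rfl, rfl⟩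
      · rfl
      · exact absurd hpL hw
      · exact absurd hpL hw
      · rfl
    exact hwq ▸ Set.mem_insert _ _
  have hZW : ∀ z ∈ Z, z ∈ Lᶜ → z ∈ insert q S := by
    intro z hz hzL
    by_contra hzS
    exact hzL (hZL z hz fun h => hzS (Set.mem_insert_of_mem _ h))
  have hsubW : insert q S ⊆ Lᶜ := by
    rintro x (rfl | hx)
    · exact hqL
    · exact fun h => h.1 hx
  -- `S + q` separates `Z` from row `i` in `r`, so `nosep` rules out fewer than `k` elements.
  have hcard : (insert q S).ncard = k := by
    have h1 := Set.ncard_insert_of_notMem hqS hS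
    refine le_antisymm (by omega) ?_
    by_contra hlt
    refine c.nosep _ (hS.insert q) (not_le.1 hlt) i hi fun j hj x hx => ?_
    by_cases hxS : x ∈ insert q S
    · exact Or.inl hxS
    refine Or.inr ⟨hxS, fun z hz hzS hzx => ?_⟩
    obtain ⟨u, v, -, h2, h3, h4, -, h6⟩ := hzx.exists_exit
      (hZL z hz fun h => hzS (Set.mem_insert_of_mem _ h)) (hrowL j hj hx)
    exact h6 (hcl u (not_not.2 h2) v h3 h4)
  have c' := c.restrict hkn (hS.insert q) hcard hcl hZW hi hrowL
  refine c.hasRootedGrid_of_restrict hk hkg hsubW (hS.insert q) hcard hcl hZW hi hrowL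
    (ih _ (hsmall (fun u v => r u v ∧ u ∈ Lᶜ ∧ v ∈ Lᶜ) (fun _ _ h => h.1) ?_) c' rfl)
  rintro ⟨-, h1, h2⟩
  rcases hpair p hpL q hqL hqS hpq with ⟨rfl, rfl⟩ | ⟨rfl, rfl⟩
  · exact h1 hpL
  · exact h2 hpL

end Tight

/-! ### Tight configurations -/

section RootedGridOfTight

variable {α : Type*} {n k g : ℕ} {r : α → α → Prop} {Z : Set α} {N : ℕ × ℕ → Set α}

theorem ConnOn.setOf_reach {P : Set α} (hs : ∀ ⦃u v⦄, r u v → r v u) (z : α) :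
    ConnOn r {v | Reach r P z v} := by
  have key : ∀ v, Reach r P z v → Reach r {v | Reach r P z v} z v := by
    intro v hv
    induction hv with
    | refl => exact Reach.refl _
    | tail h h' ih => exact ih.tail h'.1 h (h.tail h')
  exact fun u hu v hv => ((key u hu).symm hs).trans (key v hv)

/-- Taking `S = Z` makes "cut off" mean just nonempty and disjoint from `Z`, so the propagation
lemmas spread nonemptiness from a full row through `Z`-free territory. -/
theorem isCut_self {v : ℕ × ℕ} (hne : (N v).Nonempty) (hd : Disjoint (N v) Z) :
    IsCut r Z N Z v :=
  ⟨hne, fun _ hx => ⟨Set.disjoint_left.1 hd hx, fun _ hz hz' => absurd hz hz'⟩⟩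

theorem Config.hasRootedGrid_one (c : Config n 1 r Z N) (ht : IsTight n r N) (hg : 0 < g)
    (hn : 2 * g ≤ n) (hgn : g < n) : HasRootedGrid n g 1 r Z N := by
  obtain ⟨z, rfl⟩ := Set.ncard_eq_one.1 c.card
  obtain ⟨i₀, hi₀⟩ := c.row
  obtain ⟨p, q, hp, hq, hz⟩ : ∃ p q, p < n ∧ q < n ∧ z ∈ N (p, q) := by
    have h := c.nosep ∅ Set.finite_empty (by simp) i₀ hi₀
    push Not at h
    obtain ⟨j, hj, hj'⟩ := h
    obtain ⟨x, hx, hxU⟩ := Set.not_subset.1 hj'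
    have hzx : Reach r ∅ᶜ z x := by
      by_contra hcon
      exact hxU (Or.inr ⟨Set.notMem_empty x, by rintro _ rfl -; exact hcon⟩)
    rcases (hzx.symm c.symm).eq_or_mem with rfl | ⟨u, hu⟩
    · exact ⟨i₀, j, hi₀.1, hj, hx⟩
    · obtain ⟨-, v, -, -, h1, h2, -, h3, -⟩ := ht u z hu
      exact ⟨v.1, v.2, h1, h2, h3⟩
  -- The first or the last `g` columns avoid column `q` of the root `z`; here `2 * g ≤ n` is needed.
  obtain ⟨b, hb, hqb⟩ : ∃ b, b + g ≤ n ∧ ∀ j < g, b + j ≠ q := by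
    by_cases hqg : g ≤ q
    · exact ⟨0, by omega, fun j hj => by omega⟩
    · exact ⟨n - g, by omega, fun j hj => by omega⟩
  have hfree : ∀ m, ∀ j < g, Disjoint (N (m, b + j)) {z} := by
    intro m j hj
    refine Set.disjoint_singleton_right.2 fun h => ?_
    refine Set.disjoint_left.1 (c.disj (m, b + j) (p, q) ?_) h hz
    have := hqb j hj
    simp [this]
  have hcut : ∀ m < n, ∀ j < g, IsCut r {z} N {z} (m, b + j) := by
    intro m hm j hj
    exact c.isCut_col (isCut_self (hi₀.2 (b + j) (by omega)) (hfree i₀ j hj)) (by omega) hi₀.1 hm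
      fun m _ _ => hfree m j hj
  -- The grid occupies rows `1` to `g`. Row `0` stays free, and together with column `q` it leads
  -- around the grid to `z`: if `T` cut off `N (0, b)`, the cut would propagate to the branch set
  -- containing `z`.
  set T : Set α := {x | ∃ i < g, ∃ j < g, x ∈ N (1 + i, b + j)} with hT
  have hdT : ∀ v : ℕ × ℕ, (∀ i < g, ∀ j < g, v ≠ (1 + i, b + j)) → Disjoint (N v) T := by
    intro v hv
    refine Set.disjoint_left.2 ?_
    rintro x hx ⟨i, hi, j, hj, hx'⟩
    exact Set.disjoint_left.1 (c.disj _ _ (hv i hi j hj)) hx hx'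
  have hzT : z ∉ T := by
    refine Set.disjoint_left.1 (hdT (p, q) fun i _ j hj h => ?_) hz
    exact hqb j hj (Prod.ext_iff.1 h).2.symm
  have h0 := hcut 0 (by omega) 0 hg
  have h1 := hcut 1 (by omega) 0 hg
  rw [add_zero] at h0 h1
  obtain ⟨x, hx, y, hy, hxy⟩ := (c.conn_of_disjoint (by simp; omega) (by simp; omega) h0.1
    h0.disjoint).2 (1, b) (by simp [GAdj]) (by simp; omega) (by simp; omega)
  have h0T : ∀ j, Disjoint (N (0, j)) T := fun j => hdT _ fun i _ j' _ h => by
    have := (Prod.ext_iff.1 h).1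
    simp at this
    omega
  have hqT : ∀ i, Disjoint (N (i, q)) T := fun i => hdT _ fun i _ j' hj' h =>
    hqb j' hj' (Prod.ext_iff.1 h).2.symm
  have hzx : Reach r Tᶜ z x := by
    by_contra hcon
    have hxU : x ∈ Unreached r {z} T :=
      ⟨Set.disjoint_left.1 (h0T b) hx, by rintro _ rfl -; exact hcon⟩
    have e1 : IsCut r {z} N T (0, b) :=
      c.isCut_of_mem (by simp; omega) (by simp; omega) (h0T b) hx hxU
    have e2 : IsCut r {z} N T (0, q) :=
      c.isCut_row e1 (by omega) (by omega) hq fun m _ _ => h0T m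
    have e3 : IsCut r {z} N T (p, q) :=
      c.isCut_col e2 hq (by omega) hp fun m _ _ => hqT m
    exact Set.disjoint_left.1 e3.disjoint hz rfl
  refine ⟨1, b, by omega, hb, fun i hi j hj => ?_, fun _ => {v | Reach r Tᶜ z v} ∪ N (1, b),
    fun i hi => ?_, fun i hi i' hi' hii => by omega, fun i hi i' hi' j hj hne => ?_⟩
  · have := hcut (1 + i) (by omega) j hj
    exact ⟨this.1, this.disjoint⟩
  · obtain rfl : i = 0 := by omega
    refine ⟨Set.subset_union_right, ?_, z, Or.inl (Reach.refl _), rfl⟩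
    exact ConnOn.union c.symm (ConnOn.setOf_reach c.symm z)
      (c.conn_of_disjoint (by simp; omega) (by simp; omega) h1.1 h1.disjoint).1 hzx hy
      (Or.inr hxy)
  · obtain rfl : i = 0 := by omega
    rw [Set.disjoint_union_left]
    refine ⟨Set.disjoint_left.2 fun v hv hv' => ?_, c.disj _ _ (by simp; omega)⟩
    exact hv.mem (P := Tᶜ) hzT ⟨i', hi', j, hj, hv'⟩

/-- `v` lies in the square with corner `(a, b)` and side `d`, at distance at least `m` from
the sides. -/
def InSquare (a b d m : ℕ) (v : ℕ × ℕ) : Prop :=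
  a + m ≤ v.1 ∧ v.1 + m < a + d ∧ b + m ≤ v.2 ∧ v.2 + m < b + d

/-- If `S` avoids the `m`-th concentric cycle of a square, and one branch set of the cycle
is cut off from `Z` by `S`, then all are. -/
theorem Web.isCut_ring (c : Web n r Z N) {S : Set α} {a b d m i : ℕ} (ha : a + d ≤ n)
    (hb : b + d ≤ n)
    (hS : ∀ v, InSquare a b d m v → ¬ InSquare a b d (m + 1) v → Disjoint (N v) S)
    (h1 : a + m ≤ i) (h2 : i + m < a + d) (h : IsCut r Z N S (i, b + m))
    {v : ℕ × ℕ} (hv : InSquare a b d m v) (hv' : ¬ InSquare a b d (m + 1) v) :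
    IsCut r Z N S v := by
  obtain ⟨p, q⟩ := v
  simp only [InSquare] at hS hv hv'
  have left : ∀ p, a + m ≤ p → p + m < a + d → IsCut r Z N S (p, b + m) := fun p hp hp' =>
    c.isCut_col h (by omega) (by omega) (by omega) fun t _ _ => hS _ (by simp; omega)
      (by simp)
  have top : ∀ q, b + m ≤ q → q + m < b + d → IsCut r Z N S (a + m, q) := fun q hq hq' =>
    c.isCut_row (left (a + m) (by omega) (by omega)) (by omega) (by omega) (by omega)
      fun t _ _ => hS _ (by simp; omega) (by simp)
  have bot : ∀ q, b + m ≤ q → q + m < b + d → IsCut r Z N S (a + d - 1 - m, q) := fun q hq hq' =>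
    c.isCut_row (left (a + d - 1 - m) (by omega) (by omega)) (by omega) (by omega) (by omega)
      fun t _ _ => hS _ (by simp; omega) (by simp; omega)
  have right : ∀ p, a + m ≤ p → p + m < a + d → IsCut r Z N S (p, b + d - 1 - m) :=
    fun p hp hp' =>
    c.isCut_col (top (b + d - 1 - m) (by omega) (by omega)) (by omega) (by omega) (by omega)
      fun t _ _ => hS _ (by simp; omega) (by simp; omega)
  have hcase : q = b + m ∨ p = a + m ∨ p = a + d - 1 - m ∨ q = b + d - 1 - m := by omega
  rcases hcase with rfl | rfl | rfl | rfl
  · exact left p (by omega) (by omega)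
  · exact top q (by omega) (by omega)
  · exact bot q (by omega) (by omega)
  · exact right p (by omega) (by omega)

/-- If the `m`-th concentric cycle of a square free of `Z` is cut off from `Z` by `S` outside
a set `T` inside of the cycle, then it is cut off by `S`. -/
theorem Web.isCut_of_ring (c : Web n r Z N) (ht : IsTight n r N) {S T : Set α} {a b d m : ℕ}
    (hfree : ∀ v, InSquare a b d m v → Disjoint (N v) Z)
    (hT : ∀ x ∈ T, ∃ v, InSquare a b d m v ∧ x ∈ N v)
    (h : ∀ v, InSquare a b d m v → ¬ InSquare a b d (m + 1) v → IsCut r Z N (S ∪ T) v)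
    {v : ℕ × ℕ} (hv : InSquare a b d m v) (hv' : ¬ InSquare a b d (m + 1) v) :
    IsCut r Z N S v := by
  set K : Set α := {x | ∃ v, InSquare a b d m v ∧ x ∈ N v} with hK
  refine ⟨(h v hv hv').1, fun x hx => ⟨fun hxS => ((h v hv hv').2 hx).1 (Or.inl hxS), ?_⟩⟩
  intro z hz hzS hzx
  have hzK : z ∉ K := fun ⟨v, hv, hzv⟩ => Set.disjoint_left.1 (hfree v hv) hzv hz
  -- Consider the first entry into the square. By tightness it lands in a branch set of the ring,
  -- and before it the walk avoids `T`, which lies inside the square.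
  obtain ⟨u, w, h1, h2, h3, h4, -, -⟩ :=
    hzx.exists_exit (Q := Kᶜ) hzK fun h => h ⟨v, hv, hx⟩
  obtain ⟨v₀, hv₀, hwv₀⟩ := not_not.1 h3
  obtain ⟨v₁, v₂, -, -, -, -, hu, hw, huw⟩ := ht u w h4
  obtain rfl : v₂ = v₀ := by
    by_contra hne
    exact Set.disjoint_left.1 (c.disj _ _ hne) hw hwv₀
  have hv₁ : ¬ InSquare a b d m v₁ := fun hin => h2 ⟨v₁, hin, hu⟩
  have hring : ¬ InSquare a b d (m + 1) v₂ := by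
    rcases huw with rfl | huw
    · exact absurd hv₀ hv₁
    · unfold GAdj at huw
      unfold InSquare at *
      omega
  have hcut := (h v₂ hv₀ hring).2 hw
  have hsub : Sᶜ ∩ Kᶜ ⊆ (S ∪ T)ᶜ := by
    rintro y ⟨hyS, hyK⟩ (hy | hy)
    · exact hyS hy
    · exact hyK (hT y hy)
  exact hcut.2 z hz (hsub ⟨hzS, hzK⟩)
    ((h1.mono_set hsub).tail h4 (hsub ((h1.mem (P := Sᶜ ∩ Kᶜ) ⟨hzS, hzK⟩))) hcut.1)

/-- The central grid has corner `(a + k, b + k)`. Paths from `Z` avoiding it are sought to points `x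
i` immediately left of its first `k` rows; the `k` surrounding rings exceed in number any potential
separator. -/
theorem Config.hasRootedGrid_of_square (c : Config n k r Z N) (ht : IsTight n r N) (hk : 0 < k)
    (hkg : k ≤ g) {a b : ℕ} (ha : a + (g + 2 * k) ≤ n) (hb : b + (g + 2 * k) ≤ n)
    (hfree : ∀ v, InSquare a b (g + 2 * k) 0 v → Disjoint (N v) Z) :
    HasRootedGrid n g k r Z N := by
  have hblk : ∀ v, InSquare a b (g + 2 * k) 0 v → IsCut r Z N Z v := by
    rintro ⟨p, q⟩ hv
    obtain ⟨i₀, hi₀⟩ := c.row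
    -- A `Z`-free column through the square carries nonemptiness from the full row `i₀`, wherever
    -- that row is, into each row of the square.
    obtain ⟨j, hj, hcol⟩ := c.exists_col_disjoint (k := k + 1) c.finite
      (by rw [c.card]; omega) b
    have hv' := hv
    simp only [InSquare] at hv'
    refine c.isCut_row (c.isCut_col (i' := p) (isCut_self (hi₀.2 (b + j) (by omega)) (hcol i₀))
      (by omega) hi₀.1 (by omega) fun m _ _ => hcol m) (by omega) (by omega) (by omega) ?_
    intro m hm hm'
    exact hfree _ (by simp only [InSquare]; omega)
  set T : Set α := {x | ∃ i < g, ∃ j < g, x ∈ N (a + k + i, b + k + j)} with hT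
  have hdT : ∀ v : ℕ × ℕ, (∀ i < g, ∀ j < g, v ≠ (a + k + i, b + k + j)) →
      Disjoint (N v) T := by
    intro v hv
    refine Set.disjoint_left.2 ?_
    rintro x hx ⟨i, hi, j, hj, hx'⟩
    exact Set.disjoint_left.1 (c.disj _ _ (hv i hi j hj)) hx hx'
  have hTsq : ∀ m ≤ k, ∀ x ∈ T, ∃ v, InSquare a b (g + 2 * k) m v ∧ x ∈ N v := by
    rintro m hm x ⟨i, hi, j, hj, hx⟩
    exact ⟨_, by simp only [InSquare]; omega, hx⟩
  have hZT : ∀ z ∈ Z, z ∉ T := by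
    intro z hz hzT
    obtain ⟨v, hv, hzv⟩ := hTsq 0 (by omega) z hzT
    exact Set.disjoint_left.1 (hfree v hv) hzv hz
  have hedge : ∀ i : Fin k, ∃ x ∈ N (a + k + i, b + k - 1), ∃ y ∈ N (a + k + i, b + k), r x y := by
    intro i
    have := hblk (a + k + i, b + k - 1) (by simp only [InSquare]; omega)
    exact (c.conn_of_disjoint (by simp; omega) (by simp; omega) this.1 this.disjoint).2 _
      (by simp [GAdj]; omega) (by simp; omega) (by simp; omega)
  choose x hx y hy hxy using hedge
  have hxT : ∀ i, x i ∉ T := fun i => by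
    refine Set.disjoint_left.1 (hdT _ fun i' _ j _ h => ?_) (hx i)
    have := (Prod.ext_iff.1 h).2
    simp at this
    omega
  have hxinj : Function.Injective x := by
    intro i j hij
    by_contra hne
    refine Set.disjoint_left.1 (c.disj _ _ ?_) (hx i) (hij ▸ hx j)
    simpa [Fin.ext_iff] using hne
  have hXfin : (Set.range x).Finite := Set.finite_range x
  have hXcard : (Set.range x).ncard = k := by
    rw [← Set.image_univ, Set.ncard_image_of_injective _ hxinj, Set.ncard_univ]
    simp
  have hlink : Linked (fun u v => r u v ∧ u ∈ Tᶜ ∧ v ∈ Tᶜ) k Z (Set.range x) := by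
    refine linked_of_forall_separates (fun u v ⟨h1, h2, h3⟩ => ⟨c.symm h1, h3, h2⟩)
      (c.pairs_finite.subset fun p hp => hp.1) c.finite hXfin fun S hS hsep => ?_
    by_contra hlt
    rw [not_le] at hlt
    obtain ⟨i, hi, hrow⟩ := c.exists_row_disjoint hS hlt (a + k)
    obtain ⟨m, hm, hring⟩ := exists_disjoint_of_ncard_lt hS hlt
      (fun m => ⋃ v ∈ {v | InSquare a b (g + 2 * k) m v ∧ ¬ InSquare a b (g + 2 * k) (m + 1) v},
        N v) (by
      intro m _ m' _ hmm
      simp only [Set.disjoint_iUnion_left, Set.disjoint_iUnion_right]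
      intro v hv w hw
      refine c.disj _ _ ?_
      rintro rfl
      simp only [InSquare, Set.mem_ofPred_eq] at hv hw
      omega)
    simp only [Set.disjoint_iUnion_left, Set.mem_ofPred_eq] at hring
    have hx0 : x ⟨i, hi⟩ ∈ Unreached r Z (S ∪ T) := by
      have hxS := Set.disjoint_left.1 (hrow _) (hx ⟨i, hi⟩)
      refine ⟨fun h => h.elim hxS (hxT _), fun z hz hzS hzx => ?_⟩
      refine hsep z hz (fun h => hzS (Or.inl h)) _ ⟨_, rfl⟩ hxS (hzx.mono ?_ ?_)
      · exact fun u v hu hv huv => ⟨huv, fun h => hu (Or.inr h), fun h => hv (Or.inr h)⟩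
      · exact fun u hu h => hu (Or.inl h)
    have hleft : ∀ j < b + k, Disjoint (N (a + k + i, j)) (S ∪ T) := by
      intro j hj
      refine Set.disjoint_union_right.2 ⟨hrow j, hdT _ fun i' _ j' _ h => ?_⟩
      have := (Prod.ext_iff.1 h).2
      simp at this
      omega
    have hcut0 : IsCut r Z N (S ∪ T) (a + k + i, b + m) :=
      c.isCut_row (c.isCut_of_mem (v := (a + k + i, b + k - 1)) (by simp; omega) (by simp; omega)
        (hleft _ (by omega)) (hx ⟨i, hi⟩) hx0) (by omega) (by omega) (by omega)
        fun j _ _ => hleft j (by omega)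
    have hcutring : ∀ v, InSquare a b (g + 2 * k) m v → ¬ InSquare a b (g + 2 * k) (m + 1) v →
        IsCut r Z N (S ∪ T) v := by
      intro v hv hv'
      refine c.isCut_ring ha hb (fun v hv hv' => ?_) (by omega) (by omega) hcut0 hv hv'
      refine Set.disjoint_union_right.2 ⟨hring v ⟨hv, hv'⟩, hdT _ fun i hi j hj h => ?_⟩
      subst h
      simp only [InSquare] at hv hv'
      omega
    -- An `S`-free column crosses the top of the cut ring in row `a + m`. By tightness `S` alone,
    -- without `T`, cuts off this branch set.
    obtain ⟨j, hj, hcol⟩ := c.exists_col_disjoint hS hlt (b + k)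
    refine c.not_isCut hS hlt (by omega) (i := a + m) (j := b + k + j) (by omega) (by omega) hcol ?_
    refine c.isCut_of_ring ht (fun v hv => hfree v ?_) (hTsq m hm.le) hcutring ?_ ?_
    all_goals simp only [InSquare] at *; omega
  obtain ⟨P, hPc, hPZ, hPX, hPd⟩ := hlink
  obtain ⟨p, hpP, hpX, hps, hpu⟩ := exists_transversal hXfin hXcard hPd hPX
  have hPT : ∀ i, ∀ v ∈ P i, v ∉ T := by
    intro i v hv
    obtain ⟨z, hzP, hzZ⟩ := hPZ i
    rcases (hPc i z hzP v hv).eq_or_mem with rfl | ⟨u, hu⟩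
    · exact hZT z hzZ
    · exact hu.2.2
  have hm : ∀ i, ∃ m : Fin k, ∀ hi : i < k, p m = x ⟨i, hi⟩ := by
    intro i
    by_cases hi : i < k
    · obtain ⟨m, hm⟩ := hps (x ⟨i, hi⟩) ⟨_, rfl⟩
      exact ⟨m, fun _ => hm⟩
    · exact ⟨⟨0, hk⟩, fun h => absurd h hi⟩
  choose m hm using hm
  have hPN : ∀ l, ∀ i < g, ∀ j < g, Disjoint (P l) (N (a + k + i, b + k + j)) :=
    fun l i hi j hj => Set.disjoint_left.2 fun v hv hv' => hPT l v hv ⟨i, hi, j, hj, hv'⟩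
  have hPN' : ∀ l, ∀ i < g, Disjoint (P l) (N (a + k + i, b + k)) :=
    fun l i hi => hPN l i hi 0 (by omega)
  refine ⟨a + k, b + k, by omega, by omega, fun i hi j hj => ?_,
    fun i => P (m i) ∪ N (a + k + i, b + k), fun i hi => ⟨Set.subset_union_right, ?_, ?_⟩,
    fun i hi i' hi' hii => ?_, fun i hi i' hi' j hj hne => ?_⟩
  · have := hblk (a + k + i, b + k + j) (by simp only [InSquare]; omega)
    exact ⟨this.1, this.disjoint⟩
  · have := hblk (a + k + i, b + k) (by simp only [InSquare]; omega)
    exact ConnOn.union c.symm ((hPc (m i)).mono fun _ _ _ _ h => h.1)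
      (c.conn_of_disjoint (by simp; omega) (by simp; omega) this.1 this.disjoint).1
      (hm i hi ▸ hpP (m i)) (hy ⟨i, hi⟩) (Or.inr (hxy ⟨i, hi⟩))
  · exact (hPZ (m i)).mono (Set.inter_subset_inter_left _ Set.subset_union_left)
  · have hmm : m i ≠ m i' := fun h => by
      have := hxinj ((hm i hi).symm.trans ((congrArg p h).trans (hm i' hi')))
      simp at this
      exact hii this
    rw [Set.disjoint_union_left, Set.disjoint_union_right, Set.disjoint_union_right]
    exact ⟨⟨hPd _ _ hmm, hPN' _ i' (by omega)⟩, (hPN' _ i (by omega)).symm,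
      c.disj _ _ (by simpa using hii)⟩
  · rw [Set.disjoint_union_left]
    exact ⟨hPN _ i' hi' j hj, c.disj _ _ (by simp; omega)⟩

theorem Config.exists_square (c : Config n k r Z N) (hk : 2 ≤ k) (hn : k * (g + 2 * k) ≤ n) :
    ∃ a b, a + (g + 2 * k) ≤ n ∧ b + (g + 2 * k) ≤ n ∧
      ∀ v, InSquare a b (g + 2 * k) 0 v → Disjoint (N v) Z := by
  set d := g + 2 * k with hd
  have hd0 : 0 < d := by omega
  -- Among `k + 1` cells of a `k × k` array of disjoint squares, listed by quotient and remainder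
  -- modulo `k`, one misses `Z`. There are that many cells because `k + 1 ≤ k * k` for `k ≥ 2`.
  obtain ⟨m, hm, hdisj⟩ := exists_disjoint_of_ncard_lt (k := k + 1) c.finite
    (by rw [c.card]; omega)
    (fun m => ⋃ v ∈ {v : ℕ × ℕ | v.1 / d = m / k ∧ v.2 / d = m % k}, N v) (by
    intro m _ m' _ hmm
    simp only [Set.disjoint_iUnion_left, Set.disjoint_iUnion_right]
    intro v hv w hw
    refine c.disj _ _ ?_
    rintro rfl
    simp only [Set.mem_ofPred_eq] at hv hw
    refine hmm ?_
    rw [← Nat.div_add_mod m k, ← Nat.div_add_mod m' k, ← hv.1, ← hv.2, ← hw.1, ← hw.2])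
  simp only [Set.disjoint_iUnion_left, Set.mem_ofPred_eq] at hdisj
  have hbound : ∀ s < k, d * s + d ≤ n := fun s hs => by
    calc d * s + d = (s + 1) * d := by ring
      _ ≤ k * d := Nat.mul_le_mul_right _ hs
      _ ≤ n := hn
  have h1 : m / k < k := by
    rw [Nat.div_lt_iff_lt_mul (by omega)]
    nlinarith
  refine ⟨d * (m / k), d * (m % k), hbound _ h1, hbound _ (Nat.mod_lt _ (by omega)), ?_⟩
  rintro ⟨p, q⟩ ⟨e1, e2, e3, e4⟩
  refine hdisj _ ⟨?_, ?_⟩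
  · exact Nat.div_eq_of_lt_le (by rw [mul_comm]; simpa using e1)
      (by rw [add_mul, one_mul, mul_comm]; simpa using e2)
  · exact Nat.div_eq_of_lt_le (by rw [mul_comm]; simpa using e3)
      (by rw [add_mul, one_mul, mul_comm]; simpa using e4)

theorem Config.hasRootedGrid_of_lt (c : Config n k r Z N) (hk : 0 < k) (hkg : k ≤ g)
    (hn : k * (g + 2 * k) < n) (hn' : 2 * g ≤ n) : HasRootedGrid n g k r Z N := by
  have hkn : k ≤ n := by nlinarith
  refine Config.hasRootedGrid hk hkg hkn (fun r Z N c ht => ?_) c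
  rcases (show k = 1 ∨ 2 ≤ k by omega) with rfl | hk2
  · exact c.hasRootedGrid_one ht (by omega) hn' (by omega)
  · obtain ⟨a, b, ha, hb, hfree⟩ := c.exists_square hk2 hn.le
    exact c.hasRootedGrid_of_square ht hk hkg ha hb hfree

end RootedGridOfTight

/-! ### From pseudomodels to webs -/

section Graphs

variable {α β : Type*} {n g : ℕ}

theorem gridSimple_adj_iff (u v : GridVert n) :
    (gridSimple n).Adj u v ↔ GAdj ((u.1 : ℕ), (u.2 : ℕ)) ((v.1 : ℕ), (v.2 : ℕ)) := by
  simp only [gridSimple, GAdj]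
  rcases abs_cases (((v.1 : ℕ) : ℤ) - ((u.1 : ℕ) : ℤ)) with h | h <;>
    rcases abs_cases (((v.2 : ℕ) : ℤ) - ((u.2 : ℕ) : ℤ)) with h' | h' <;>
    rw [h.1, h'.1] <;> omega

theorem grid_isLink_iff {e : GridEdge n} {u v : GridVert n} :
    (grid n).IsLink e u v ↔ e = s(u, v) ∧ (gridSimple n).Adj u v := by
  constructor
  · rintro ⟨rfl, h⟩
    exact ⟨rfl, h⟩
  · rintro ⟨rfl, h⟩
    exact ⟨rfl, h⟩

theorem Joined.reach {G H : Graph α β} (hHG : H ≤ G) {x y : α} (h : Joined H x y) :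
    Reach G.Adj V(H) x y :=
  Relation.ReflTransGen.mono (fun _ _ h => ⟨h.mono hHG, h.left_mem, h.right_mem⟩) _ _ h

theorem isConnected_induce {G : Graph α β} {X : Set α} (hne : X.Nonempty)
    (h : ConnOn G.Adj X) : IsConnected (G.induce X) := by
  refine ⟨hne, fun x hx y hy => ?_⟩
  exact Relation.ReflTransGen.mono (fun _ _ ⟨⟨e, he⟩, h1, h2⟩ => ⟨e, he, h1, h2⟩) _ _ (h x hx y hy)

theorem exists_joined_of_isComponent {G : Graph α β} {Z : Set α}
    (h : ∀ C : Graph α β, IsComponent C G → (V(C) ∩ Z).Nonempty) {x : α} (hx : x ∈ V(G)) :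
    ∃ z ∈ Z, z ∈ V(G) ∧ Joined G x z := by
  obtain ⟨z, hz, hzZ⟩ := h _ ⟨x, hx, rfl⟩
  exact ⟨z, hzZ, hz⟩

/-- The vertex sets of the graphs `η v`, indexed by the coordinates of `v`. -/
def branchSets (J : Graph (GridVert n) (GridEdge n)) (η : GraphMap (GridVert n) (GridEdge n) α β)
    (v : ℕ × ℕ) : Set α :=
  {x | ∃ u ∈ V(J), ((u.1 : ℕ), (u.2 : ℕ)) = v ∧ x ∈ V(η.vert u)}

variable {J : Graph (GridVert n) (GridEdge n)} {η : GraphMap (GridVert n) (GridEdge n) α β}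
  {G : Graph α β} {Z : Set α}

theorem coord_injective {u v : GridVert n}
    (h : ((u.1 : ℕ), (u.2 : ℕ)) = ((v.1 : ℕ), (v.2 : ℕ))) : u = v := by
  simp only [Prod.mk.injEq] at h
  exact Prod.ext (Fin.ext h.1) (Fin.ext h.2)

theorem branchSets_eq {u : GridVert n} (hu : u ∈ V(J)) :
    branchSets J η ((u.1 : ℕ), (u.2 : ℕ)) = V(η.vert u) := by
  ext x
  constructor
  · rintro ⟨v, -, hvu, hx⟩
    exact coord_injective hvu ▸ hx
  · exact fun hx => ⟨u, hu, rfl, hx⟩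

theorem mem_of_branchSets_nonempty {u : GridVert n}
    (h : (branchSets J η ((u.1 : ℕ), (u.2 : ℕ))).Nonempty) : u ∈ V(J) := by
  obtain ⟨x, v, hv, hvu, -⟩ := h
  exact coord_injective hvu ▸ hv

theorem isLink_of_notMem_boundary (hJ : J ≤ grid n) {u v : GridVert n} (hu : u ∈ V(J))
    (hub : u ∉ boundary (grid n) J) (huv : (gridSimple n).Adj u v) : J.IsLink s(u, v) u v := by
  have hl : (grid n).IsLink s(u, v) u v := grid_isLink_iff.2 ⟨rfl, huv⟩
  have he : s(u, v) ∈ E(J) := by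
    by_contra he
    exact hub ⟨hu, _, hl.edge_mem, he, hl.inc_left⟩
  exact (hJ.isLink_iff he).2 hl

/-- Avoiding the boundary gives every grid edge at `v` to `J`, and the pseudomodel realises these
edges; this is the joining condition of a web. -/
theorem web_branchSets (hJ : J ≤ grid n) (hη : IsPseudomodel J G η)
    (h1 : ∀ v ∈ V(J),
      (IsConnected (η.vert v) ∧ v ∉ boundary (grid n) J) ∨
      ∀ C : Graph α β, IsComponent C (η.vert v) → (V(C) ∩ Z).Nonempty) :
    Web n G.Adj Z (branchSets J η) where
  symm _ _ h := h.symm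
  disj := by
    refine fun u v huv => Set.disjoint_left.2 ?_
    rintro x ⟨u', hu', rfl, hx⟩ ⟨v', hv', rfl, hx'⟩
    exact Set.disjoint_left.1 (hη.vert_disjoint u' hu' v' hv' fun h => huv (h ▸ rfl)) hx hx'
  good := by
    rintro v - - ⟨-, u, hu, rfl, -⟩
    rw [branchSets_eq hu]
    rcases h1 u hu with ⟨hc, hb⟩ | hc
    · refine Or.inl ⟨fun x hx y hy => (hc.2 x hx y hy).reach (hη.vert_le u hu), ?_⟩
      rintro ⟨p, q⟩ hadj hp hq
      have hl := isLink_of_notMem_boundary (v := ((⟨p, hp⟩, ⟨q, hq⟩) : GridVert n)) hJ hu hb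
        ((gridSimple_adj_iff _ _).2 hadj)
      obtain ⟨x, hx, y, hy, hxy⟩ := hη.edge_link _ _ _ hl
      exact ⟨x, hx, y, ⟨_, hl.right_mem, rfl, hy⟩, hxy.adj⟩
    · refine Or.inr fun x hx => ?_
      obtain ⟨z, hz, -, hxz⟩ := exists_joined_of_isComponent hc hx
      exact ⟨z, hz, hxz.reach (hη.vert_le u hu)⟩

/-- The separation of `G` given by a vertex set `S` and the vertices it separates from `Z`. -/
theorem exists_isSeparation (hZ : Z ⊆ V(G)) {S : Set α} (hS : S.Finite) :
    ∃ A B : Graph α β, IsSeparation G A B ∧ sepOrder A B ≤ S.ncard ∧ Z ⊆ V(A) ∧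
      ∀ x ∈ V(G), x ∈ S ∪ Unreached G.Adj Z S → x ∈ V(B) := by
  set D : Set α := V(G) ∩ Unreached G.Adj Z S with hD
  have hcl : ∀ x ∈ D, ∀ y e, G.IsLink e x y → y ∈ D ∪ (S ∩ V(G)) := by
    intro x hx y e he
    by_cases hyS : y ∈ S
    · exact Or.inr ⟨hyS, he.right_mem⟩
    · exact Or.inl ⟨he.right_mem, mem_unreached_of_reach (fun _ _ h => h.symm) hx.2
        (Reach.single he.adj hx.2.1 hyS)⟩
  have hEA : ∀ e x y, G.IsLink e x y → (e ∈ E(G.deleteVerts D) ↔ x ∉ D ∧ y ∉ D) := by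
    intro e x y he
    rw [Graph.edgeSet_deleteVerts]
    constructor
    · rintro ⟨x', y', he', hx', hy'⟩
      rcases he.eq_and_eq_or_eq_and_eq he' with ⟨rfl, rfl⟩ | ⟨rfl, rfl⟩
      · exact ⟨hx', hy'⟩
      · exact ⟨hy', hx'⟩
    · exact fun h => ⟨x, y, he, h⟩
  have hsub : D ∪ (S ∩ V(G)) ⊆ V(G) := by
    rintro x (hx | hx)
    · exact hx.1
    · exact hx.2
  -- Edges with both ends in `S` would lie on both sides; they are assigned to `A`.
  refine ⟨G.deleteVerts D, (G.induce (D ∪ (S ∩ V(G)))).deleteEdges E(G.deleteVerts D),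
    ⟨Graph.deleteVerts_le, Graph.deleteEdges_le.trans (Graph.induce_le hsub), ?_, ?_, ?_⟩,
    ?_, ?_, ?_⟩
  · rw [Graph.vertexSet_deleteVerts, Graph.vertexSet_deleteEdges, Graph.vertexSet_induce]
    refine Set.Subset.antisymm (Set.union_subset Set.sdiff_subset hsub) fun x hx => ?_
    by_cases hxD : x ∈ D
    · exact Or.inr (Or.inl hxD)
    · exact Or.inl ⟨hx, hxD⟩
  · rw [Graph.edgeSet_deleteEdges]
    refine Set.Subset.antisymm (Set.union_subset Graph.deleteVerts_le.edgeSet_mono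
      (Set.sdiff_subset.trans (Graph.induce_le hsub).edgeSet_mono)) fun e he => ?_
    by_cases heA : e ∈ E(G.deleteVerts D)
    · exact Or.inl heA
    · refine Or.inr ⟨?_, heA⟩
      obtain ⟨x, y, hxy⟩ := Graph.exists_isLink_of_mem_edgeSet he
      rw [Graph.edgeSet_induce]
      have h := mt (hEA e x y hxy).2 heA
      by_cases hx : x ∈ D
      · exact ⟨x, y, hxy, Or.inl hx, hcl x hx y e hxy⟩
      · have hy : y ∈ D := by
          by_contra hy
          exact h ⟨hx, hy⟩
        exact ⟨x, y, hxy, hcl y hy x e hxy.symm, Or.inl hy⟩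
  · rw [Graph.edgeSet_deleteEdges]
    exact Set.inter_sdiff_self _ _
  · refine Set.ncard_le_ncard ?_ hS
    rw [Graph.vertexSet_deleteVerts, Graph.vertexSet_deleteEdges, Graph.vertexSet_induce]
    rintro x ⟨hx, hx' | hx'⟩
    · exact absurd hx' hx.2
    · exact hx'.1
  · rw [Graph.vertexSet_deleteVerts]
    exact fun z hz => ⟨hZ hz, fun h => h.2.2 z hz h.2.1 (Reach.refl _)⟩
  · rw [Graph.vertexSet_deleteEdges, Graph.vertexSet_induce]
    rintro x hx (h | h)
    · exact Or.inr ⟨h, hx⟩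
    · exact Or.inl ⟨hx, h⟩

theorem config_branchSets {k : ℕ} (hV : V(G).Finite) (hZ : Z ⊆ V(G)) (hZk : Z.ncard = k)
    (hJ : J ≤ grid n) (hrow : ∃ i : Fin n, row n i ⊆ V(J)) (hη : IsPseudomodel J G η)
    (h1 : ∀ v ∈ V(J),
      (IsConnected (η.vert v) ∧ v ∉ boundary (grid n) J) ∨
      ∀ C : Graph α β, IsComponent C (η.vert v) → (V(C) ∩ Z).Nonempty)
    (h2 : ¬ ∃ A B : Graph α β, IsSeparation G A B ∧ sepOrder A B < k ∧
      Z ⊆ V(A) ∧ ∃ i : Fin n, row n i ⊆ V(J) ∧ η.image (row n i) ⊆ V(B)) :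
    Config n k G.Adj Z (branchSets J η) := by
  refine { web_branchSets hJ hη h1 with
    pairs_finite := (hV.prod hV).subset fun p hp => ⟨hp.left_mem, hp.right_mem⟩
    finite := hV.subset hZ
    card := hZk
    row := ?_
    nosep := ?_ }
  · obtain ⟨i, hi⟩ := hrow
    refine ⟨i, i.2, fun j hj => ?_⟩
    have hm : ((i, ⟨j, hj⟩) : GridVert n) ∈ V(J) := hi rfl
    exact (branchSets_eq (η := η) hm) ▸ hη.vert_nonempty _ hm
  · intro S hS hSk i hi hcut
    have hiJ : row n ⟨i, hi.1⟩ ⊆ V(J) := by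
      rintro ⟨p, q⟩ rfl
      exact mem_of_branchSets_nonempty (hi.2 q q.2)
    obtain ⟨A, B, hAB, hord, hZA, hB⟩ := exists_isSeparation hZ hS
    refine h2 ⟨A, B, hAB, hord.trans_lt hSk, hZA, ⟨i, hi.1⟩, hiJ, ?_⟩
    intro x hx
    simp only [GraphMap.image, Set.mem_iUnion] at hx
    obtain ⟨v, hv, hxv⟩ := hx
    have hvJ := hiJ hv
    obtain ⟨p, q⟩ := v
    obtain rfl : p = ⟨i, hi.1⟩ := hv
    exact hB x ((hη.vert_le _ hvJ).vertexSet_mono hxv)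
      (hcut q q.2 ((branchSets_eq (η := η) hvJ).symm ▸ hxv))

/-! ### From rooted grids to augmentable models -/

/-- The translation of the `g × g` grid by `(a, b)` into the `n × n` grid. -/
def shift {a b : ℕ} (ha : a + g ≤ n) (hb : b + g ≤ n) (u : GridVert g) : GridVert n :=
  (⟨a + u.1, by omega⟩, ⟨b + u.2, by omega⟩)

section Shift

variable {a b : ℕ} (ha : a + g ≤ n) (hb : b + g ≤ n)

theorem shift_injective : Function.Injective (shift (g := g) ha hb) := by
  intro u v h
  simp only [shift, Prod.mk.injEq, Fin.mk.injEq] at h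
  exact Prod.ext (Fin.ext (by omega)) (Fin.ext (by omega))

theorem gridSimple_adj_shift (u v : GridVert g) :
    (gridSimple n).Adj (shift ha hb u) (shift ha hb v) ↔ (gridSimple g).Adj u v := by
  rw [gridSimple_adj_iff, gridSimple_adj_iff]
  simp only [shift, GAdj]
  omega

theorem isIso_shift (hJ : J ≤ grid n)
    (hl : ∀ u v : GridVert g, (gridSimple g).Adj u v →
      J.IsLink s(shift ha hb u, shift ha hb v) (shift ha hb u) (shift ha hb v)) :
    IsIso (grid g) (J.induce (Set.range (shift ha hb))) (shift ha hb)
      (Sym2.map (shift ha hb)) where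
  bijOn_vert := ⟨fun u _ => ⟨u, rfl⟩, (shift_injective ha hb).injOn,
    by rintro _ ⟨u, rfl⟩; exact ⟨u, trivial, rfl⟩⟩
  bijOn_edge := by
    refine ⟨fun e he => ?_, (Sym2.map.injective (shift_injective ha hb)).injOn, ?_⟩
    · obtain ⟨u, v, huv⟩ := Graph.exists_isLink_of_mem_edgeSet he
      obtain ⟨rfl, hadj⟩ := grid_isLink_iff.1 huv
      exact ⟨_, _, hl u v hadj, ⟨u, rfl⟩, ⟨v, rfl⟩⟩
    · rintro e ⟨_, _, he, ⟨u, rfl⟩, ⟨v, rfl⟩⟩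
      obtain ⟨rfl, huv⟩ := grid_isLink_iff.1 (he.mono hJ)
      exact ⟨s(u, v), (grid_isLink_iff.2 ⟨rfl, (gridSimple_adj_shift ha hb u v).1 huv⟩).edge_mem,
        rfl⟩
  isLink_iff := by
    intro e _ x _ y _
    constructor
    · intro h
      obtain ⟨rfl, hxy⟩ := grid_isLink_iff.1 h
      exact ⟨hl x y hxy, ⟨x, rfl⟩, ⟨y, rfl⟩⟩
    · rintro ⟨h, -, -⟩
      obtain ⟨he, hxy⟩ := grid_isLink_iff.1 (h.mono hJ)
      refine grid_isLink_iff.2 ⟨?_, (gridSimple_adj_shift ha hb x y).1 hxy⟩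
      exact Sym2.map.injective (shift_injective ha hb) he

end Shift

theorem isIso_id (H : Graph α β) : IsIso H H id id where
  bijOn_vert := Set.bijOn_id _
  bijOn_edge := Set.bijOn_id _
  isLink_iff _ _ _ _ _ _ := Iff.rfl

/-- Enlarging the branch sets of a model of the grid to disjoint connected subgraphs. -/
theorem IsModel.enlarge {μ μ' : GraphMap (GridVert g) (GridEdge g) α β}
    (h : IsModel (grid g) G μ) (he : μ'.edge = μ.edge)
    (hle : ∀ v, μ'.vert v ≤ G) (hsub : ∀ v, V(μ.vert v) ⊆ V(μ'.vert v))
    (hd : ∀ u v, u ≠ v → Disjoint V(μ'.vert u) V(μ'.vert v))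
    (hc : ∀ v, IsConnected (μ'.vert v)) : IsModel (grid g) G μ' where
  vert_le v _ := hle v
  vert_nonempty v _ := (hc v).1
  vert_disjoint u _ v _ huv := hd u v huv
  edge_mem := he ▸ h.edge_mem
  edge_injOn := he ▸ h.edge_injOn
  -- An edge inside an enlarged branch set would have both ends there, but its ends lie in the
  -- disjoint sets of two different grid vertices.
  edge_notMem := by
    intro e heg v _ hev
    obtain ⟨p, q, hpq⟩ := Graph.exists_isLink_of_mem_edgeSet heg
    obtain ⟨x, hx, y, hy, hxy⟩ := h.edge_link e p q hpq
    rw [he] at hev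
    have hl := ((hle v).isLink_iff hev).2 hxy
    have key : ∀ p x, x ∈ V(μ.vert p) → x ∈ V(μ'.vert v) → p = v := by
      intro p x hx hx'
      by_contra hne
      exact Set.disjoint_left.1 (hd p v hne) (hsub p hx) hx'
    have h1 := key p x hx hl.left_mem
    have h2 := key q y hy hl.right_mem
    subst h1
    subst h2
    exact (grid_isLink_iff.1 hpq).2.ne rfl
  edge_link := by
    intro e u v huv
    obtain ⟨x, hx, y, hy, hxy⟩ := h.edge_link e u v huv
    exact ⟨x, hsub u hx, y, hsub v hy, he ▸ hxy⟩
  vert_connected v _ := hc v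

theorem isModel_shift {a b : ℕ} (ha : a + g ≤ n) (hb : b + g ≤ n) (hη : IsPseudomodel J G η)
    (hm : ∀ u, shift (g := g) ha hb u ∈ V(J))
    (hl : ∀ u v : GridVert g, (gridSimple g).Adj u v →
      J.IsLink s(shift ha hb u, shift ha hb v) (shift ha hb u) (shift ha hb v))
    (hc : ∀ u, IsConnected (η.vert (shift (g := g) ha hb u))) :
    IsModel (grid g) G (η.comp (shift ha hb) (Sym2.map (shift ha hb))) := by
  have hE : ∀ e ∈ E(grid g), Sym2.map (shift ha hb) e ∈ E(J) := by
    intro e he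
    obtain ⟨u, v, huv⟩ := Graph.exists_isLink_of_mem_edgeSet he
    obtain ⟨rfl, hadj⟩ := grid_isLink_iff.1 huv
    exact (hl u v hadj).edge_mem
  exact
  { vert_le := fun v _ => hη.vert_le _ (hm v)
    vert_nonempty := fun v _ => hη.vert_nonempty _ (hm v)
    vert_disjoint := fun u _ v _ huv => hη.vert_disjoint _ (hm u) _ (hm v)
      fun h => huv (shift_injective ha hb h)
    edge_mem := fun e he => hη.edge_mem _ (hE e he)
    edge_injOn := fun e he e' he' h => Sym2.map.injective (shift_injective ha hb)
      (hη.edge_injOn (hE e he) (hE e' he') h)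
    edge_notMem := fun e he v _ => hη.edge_notMem _ (hE e he) _ (hm v)
    edge_link := by
      intro e u v huv
      obtain ⟨rfl, hadj⟩ := grid_isLink_iff.1 huv
      exact hη.edge_link _ _ _ (hl u v hadj)
    vert_connected := fun v _ => hc v }

theorem isAugmentable_of_enlargement {a b : ℕ} (ha : a + g ≤ n) (hb : b + g ≤ n)
    (hmodel : IsModel (grid g) G (η.comp (shift ha hb) (Sym2.map (shift ha hb))))
    (hm : ∀ u, shift (g := g) ha hb u ∈ V(J)) {U : ℕ → Set α}
    (hU : ∀ i < Z.ncard, branchSets J η (a + i, b) ⊆ U i ∧ ConnOn G.Adj (U i) ∧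
      (U i ∩ Z).Nonempty)
    (hUd : ∀ i < Z.ncard, ∀ i' < Z.ncard, i ≠ i' → Disjoint (U i) (U i'))
    (hUN : ∀ i < Z.ncard, ∀ i' < g, ∀ j < g, ¬ (i' = i ∧ j = 0) →
      Disjoint (U i) (branchSets J η (a + i', b + j)))
    (hZ : Z ⊆ V(G)) :
    IsAugmentable G Z g (η.comp (shift ha hb) (Sym2.map (shift ha hb))) := by
  classical
  set μ := η.comp (shift (g := g) ha hb) (Sym2.map (shift ha hb)) with hμ
  have hN : ∀ i j : Fin g, branchSets J η (a + i, b + j) = V(μ.vert (i, j)) :=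
    fun i j => branchSets_eq (hm (i, j))
  have hN0 : ∀ i j : Fin g, (j : ℕ) = 0 → branchSets J η (a + i, b) = V(μ.vert (i, j)) := by
    intro i j hj
    rw [← hN, hj, add_zero]
  have hUG : ∀ i < Z.ncard, U i ⊆ V(G) := by
    intro i hi x hx
    obtain ⟨-, hc, z, hzU, hzZ⟩ := hU i hi
    rcases (hc z hzU x hx).eq_or_mem with rfl | ⟨u, hu⟩
    · exact hZ hzZ
    · exact hu.right_mem
  let μ' : GraphMap (GridVert g) (GridEdge g) α β :=
    ⟨fun v => if (v.2 : ℕ) = 0 ∧ (v.1 : ℕ) < Z.ncard then G.induce (U v.1) else μ.vert v, μ.edge⟩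
  have hpos : ∀ v : GridVert g, ((v.2 : ℕ) = 0 ∧ (v.1 : ℕ) < Z.ncard) →
      μ'.vert v = G.induce (U v.1) := fun v hv => if_pos hv
  have hneg : ∀ v : GridVert g, ¬ ((v.2 : ℕ) = 0 ∧ (v.1 : ℕ) < Z.ncard) →
      μ'.vert v = μ.vert v := fun v hv => if_neg hv
  have hsubU : ∀ v : GridVert g, ((v.2 : ℕ) = 0 ∧ (v.1 : ℕ) < Z.ncard) →
      V(μ.vert v) ⊆ U v.1 := fun v hv => hN0 v.1 v.2 hv.1 ▸ (hU v.1 hv.2).1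
  have hUμ : ∀ u v : GridVert g, ((u.2 : ℕ) = 0 ∧ (u.1 : ℕ) < Z.ncard) → u ≠ v →
      Disjoint (U u.1) V(μ.vert v) := by
    intro u v hu huv
    rw [← hN v.1 v.2]
    refine hUN _ hu.2 _ v.1.2 _ v.2.2 fun h => huv ?_
    exact Prod.ext (Fin.ext h.1.symm) (Fin.ext (hu.1.trans h.2.symm))
  -- The enlarged sets already belong to the first column of the translated grid, so no relabelling
  -- is needed.
  refine ⟨hmodel, id, id, isIso_id _, μ', ⟨hmodel.enlarge rfl ?_ ?_ ?_ ?_, ?_, ?_, ?_, ?_, ?_⟩⟩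
  · intro v
    by_cases hv : (v.2 : ℕ) = 0 ∧ (v.1 : ℕ) < Z.ncard
    · rw [hpos v hv]
      exact Graph.induce_le (hUG _ hv.2)
    · rw [hneg v hv]
      exact hmodel.vert_le v trivial
  · intro v
    by_cases hv : (v.2 : ℕ) = 0 ∧ (v.1 : ℕ) < Z.ncard
    · rw [hpos v hv]
      exact hsubU v hv
    · rw [hneg v hv]
  · intro u v huv
    by_cases hu : (u.2 : ℕ) = 0 ∧ (u.1 : ℕ) < Z.ncard <;>
      by_cases hv : (v.2 : ℕ) = 0 ∧ (v.1 : ℕ) < Z.ncard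
    · rw [hpos u hu, hpos v hv]
      refine hUd _ hu.2 _ hv.2 fun h => huv ?_
      exact Prod.ext (Fin.ext h) (Fin.ext (hu.1.trans hv.1.symm))
    · rw [hpos u hu, hneg v hv]
      exact hUμ u v hu huv
    · rw [hneg u hu, hpos v hv]
      exact (hUμ v u hv huv.symm).symm
    · rw [hneg u hu, hneg v hv]
      exact hmodel.vert_disjoint u trivial v trivial huv
  · intro v
    by_cases hv : (v.2 : ℕ) = 0 ∧ (v.1 : ℕ) < Z.ncard
    · rw [hpos v hv]
      exact isConnected_induce ((hU _ hv.2).2.2.mono Set.inter_subset_left) (hU _ hv.2).2.1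
    · rw [hneg v hv]
      exact hmodel.vert_connected v trivial
  · exact fun i j hj => hneg _ fun h => hj h.1
  · exact fun i j _ hi => hneg _ fun h => absurd h.2 (not_lt.2 hi)
  · intro i j hj hi
    rw [hpos (i, j) ⟨hj, hi⟩]
    have hle : μ.vert (i, j) ≤ G := hmodel.vert_le (i, j) trivial
    exact ⟨hsubU (i, j) ⟨hj, hi⟩, fun e x y hxy => ⟨hxy.mono hle,
      hsubU (i, j) ⟨hj, hi⟩ hxy.left_mem, hsubU (i, j) ⟨hj, hi⟩ hxy.right_mem⟩⟩
  · intro i j hj hi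
    rw [hpos (i, j) ⟨hj, hi⟩]
    exact (hU i hi).2.2
  · exact fun e _ => rfl

end Graphs

end RootedGrid

/-! ### The main theorem -/

theorem theorem2p1 {α β : Type*} (g k n : ℕ) (hk : 1 ≤ k) (hgk : k ≤ g)
    (hn : k * (g + 2 * k) < n)
    -- for `k ≥ 2` the next bound follows from the previous one
    (hn' : 2 * g ≤ n)
    (G : Graph α β) (hV : V(G).Finite) (hE : E(G).Finite)
    (Z : Set α) (hZ : Z ⊆ V(G)) (hZk : Z.ncard = k)
    (J : Graph (RootedGrid.GridVert n) (RootedGrid.GridEdge n))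
    (hJ : J ≤ RootedGrid.grid n)
    (hrow : ∃ i : Fin n, RootedGrid.row n i ⊆ V(J))
    (η : RootedGrid.GraphMap (RootedGrid.GridVert n) (RootedGrid.GridEdge n) α β)
    (hη : RootedGrid.IsPseudomodel J G η)
    (h1 : ∀ v ∈ V(J),
      (RootedGrid.IsConnected (η.vert v) ∧ v ∉ RootedGrid.boundary (RootedGrid.grid n) J) ∨
      ∀ C : Graph α β, RootedGrid.IsComponent C (η.vert v) → (V(C) ∩ Z).Nonempty)
    (h2 : ¬ ∃ A B : Graph α β, RootedGrid.IsSeparation G A B ∧ RootedGrid.sepOrder A B < k ∧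
      Z ⊆ V(A) ∧
      ∃ i : Fin n, RootedGrid.row n i ⊆ V(J) ∧ η.image (RootedGrid.row n i) ⊆ V(B)) :
    ∃ H : Graph (RootedGrid.GridVert n) (RootedGrid.GridEdge n), H ≤ J ∧
      ∃ (f : RootedGrid.GridVert g → RootedGrid.GridVert n)
        (h : RootedGrid.GridEdge g → RootedGrid.GridEdge n),
        RootedGrid.IsIso (RootedGrid.grid g) H f h ∧
        (∀ v ∈ V(H), Z ∩ V(η.vert v) = ∅) ∧
        RootedGrid.IsAugmentable G Z g (η.comp f h) := by
  subst hZk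
  have c := RootedGrid.config_branchSets hV hZ rfl hJ hrow hη h1 h2
  obtain ⟨a, b, ha, hb, hN, U, hU, hUd, hUN⟩ := c.hasRootedGrid_of_lt hk hgk hn hn'
  have hm : ∀ u : RootedGrid.GridVert g, RootedGrid.shift ha hb u ∈ V(J) := fun u =>
    RootedGrid.mem_of_branchSets_nonempty (hN u.1 u.1.2 u.2 u.2.2).1
  have hdisj : ∀ u : RootedGrid.GridVert g,
      Disjoint V(η.vert (RootedGrid.shift ha hb u)) Z := fun u =>
    RootedGrid.branchSets_eq (η := η) (hm u) ▸ (hN u.1 u.1.2 u.2 u.2.2).2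
  -- A nonempty branch set disjoint from `Z` has a component missing `Z`, so only the first
  -- alternative of (i) remains.
  have hgood : ∀ u : RootedGrid.GridVert g,
      RootedGrid.IsConnected (η.vert (RootedGrid.shift ha hb u)) ∧
        RootedGrid.shift ha hb u ∉ RootedGrid.boundary (RootedGrid.grid n) J := by
    intro u
    rcases h1 _ (hm u) with h | h
    · exact h
    · obtain ⟨x, hx⟩ := hη.vert_nonempty _ (hm u)
      obtain ⟨z, hz, hzV, -⟩ := RootedGrid.exists_joined_of_isComponent h hx
      exact absurd hz (Set.disjoint_left.1 (hdisj u) hzV)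
  have hl : ∀ u v : RootedGrid.GridVert g, (RootedGrid.gridSimple g).Adj u v →
      J.IsLink s(RootedGrid.shift ha hb u, RootedGrid.shift ha hb v)
        (RootedGrid.shift ha hb u) (RootedGrid.shift ha hb v) := fun u v huv =>
    RootedGrid.isLink_of_notMem_boundary hJ (hm u) (hgood u).2
      ((RootedGrid.gridSimple_adj_shift ha hb u v).2 huv)
  have hmodel := RootedGrid.isModel_shift ha hb hη hm hl fun u => (hgood u).1
  refine ⟨J.induce (Set.range (RootedGrid.shift ha hb)),
    Graph.induce_le (by rintro _ ⟨u, rfl⟩; exact hm u), RootedGrid.shift ha hb,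
    Sym2.map (RootedGrid.shift ha hb), RootedGrid.isIso_shift ha hb hJ hl, ?_,
    RootedGrid.isAugmentable_of_enlargement ha hb hmodel hm hU hUd hUN hZ⟩
  rintro _ ⟨u, rfl⟩
  exact (hdisj u).symm.inter_eq
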